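/- Let $M$ be a connected, simply connected, finite-dimensional smooth manifold with a Riemannian metric $\widetilde g$ and let $Z$ be a smooth vector field with $\|Z\|_{\widetilde g}=1$. Let $V=\operatorname{span}\{Z\}$, let $\mathcal F$ be the foliation of $M$ tangent to $V$, let $D=V^{\perp}$ be the $\widetilde g$-orthogonal complement of $V$, and let $\mathrm{pr}_V,\mathrm{pr}_D$ be the orthogonal projections. Assume that $\mathcal F$ is a Riemannian foliation of $(M,\widetilde g)$, i.e. $\mathcal L_Y(\mathrm{pr}_D^*\widetilde g)=0$ for every smooth section $Y$ of $V$. For a Riemannian metric $g$, the second fundamental form of the leaves of $\mathcal F$ is $\mathrm{II}(A,B)=\mathrm{pr}\,\nabla^{g}_{\mathrm{pr}' A}\,\mathrm{pr}'B$, where $\nabla^g$ is the Levi-Civita connection and $\mathrm{pr}'$, $\mathrm{pr}$ are the $g$-orthogonal projections onto $V$ and onto its $g$-orthogonal complement; $\mathcal F$ is totally geodesic for $g$ if $\mathrm{II}=0$. Let $N=\mathrm{II}(Z,Z)$, computed with $\widetilde g$, be the mean curvature vector field of $\mathcal F$, and let $\mathcal R(X,Y)=\mathrm{pr}_V[\mathrm{pr}_DX,\mathrm{pr}_DY]$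 be the curvature of $D$, a vector-valued two-form; assume that $\mathcal R$ vanishes at no point of $M$. Let $\|\mathcal R\|_{\widetilde g}$ be its norm, $\|\mathcal R\|^2_{\widetilde g}=\sum_{i<j}\|\mathcal R(e_i,e_j)\|^2_{\widetilde g}$ for any $\widetilde g$-orthonormal basis $(e_i)$ of the tangent space. For a smooth function $f$ define $\nabla f$ and $\nabla^Df$ by $df(X)=\widetilde g(X,\nabla f)$ and $df(\mathrm{pr}_DX)=\widetilde g(X,\nabla^Df)$. Then there exists a Riemannian metric $g$ on $M$ such that $D$ and $V$ are $g$-orthogonal and $\mathcal F$ is totally geodesic for $g$ if and only if there exists $f\in C^\infty(M)$ such that $$N=-\nabla^D\log\|\mathcal R\|_{\widetilde g}+\nabla f .$$ -/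

import Mathlib

open Bundle Manifold VectorField
open scoped ContDiff

set_option linter.unusedSectionVars false

noncomputable section

namespace LineFoliation

section

variable {E : Type*} [NormedAddCommGroup E] [NormedSpace ℝ E]
  {M : Type*} [TopologicalSpace M] [ChartedSpace E M]

variable (E M) in
/-- Vector fields on the manifold `M` modelled on `E` (no regularity). -/
abbrev VField : Type _ := Π x : M, TangentSpace 𝓘(ℝ, E) x

variable [IsManifold 𝓘(ℝ, E) ∞ M]

/-- `X` is a smooth section of the tangent bundle. -/
def IsSmoothField (X : VField E M) : Prop :=
  ContMDiff 𝓘(ℝ, E) (𝓘(ℝ, E).prod 𝓘(ℝ, E)) ∞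
    (fun x ↦ (TotalSpace.mk' E x (X x) : TangentBundle 𝓘(ℝ, E) M))

variable (E M) in
/-- Smooth Riemannian metrics on `M`. -/
abbrev Metric : Type _ :=
  ContMDiffRiemannianMetric 𝓘(ℝ, E) ∞ E (fun x : M ↦ TangentSpace 𝓘(ℝ, E) x)

/-- The function `g(X, Y)`. -/
def innerFun (g : Metric E M) (X Y : VField E M) (x : M) : ℝ := g.inner x (X x) (Y x)

/-- The derivative `X f` of a function along a vector field. -/
def derivAlong (X : VField E M) (f : M → ℝ) (x : M) : ℝ := mvfderiv 𝓘(ℝ, E) f x (X x)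

/-! ### Musical isomorphism and gradients -/

variable [FiniteDimensional ℝ E]

instance (x : M) : FiniteDimensional ℝ (TangentSpace 𝓘(ℝ, E) x) :=
  inferInstanceAs (FiniteDimensional ℝ E)

instance (x : M) : T2Space (TangentSpace 𝓘(ℝ, E) x) :=
  inferInstanceAs (T2Space E)

/-- The isomorphism `v ↦ g(v, ·)` from `T_x M` to its dual. -/
def flat (g : Metric E M) (x : M) :
    TangentSpace 𝓘(ℝ, E) x ≃ₗ[ℝ] (TangentSpace 𝓘(ℝ, E) x →L[ℝ] ℝ) :=
  LinearEquiv.ofBijective (g.inner x).toLinearMap <| by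
    have hinj : Function.Injective (g.inner x).toLinearMap := by
      rw [← LinearMap.ker_eq_bot, LinearMap.ker_eq_bot']
      intro v hv
      by_contra h
      have h1 := g.pos x v h
      have h2 : g.inner x v = 0 := hv
      simp [h2] at h1
    refine ⟨hinj, ?_⟩
    let e : (TangentSpace 𝓘(ℝ, E) x →ₗ[ℝ] ℝ) ≃ₗ[ℝ] (TangentSpace 𝓘(ℝ, E) x →L[ℝ] ℝ) :=
      LinearMap.toContinuousLinearMap
    have : FiniteDimensional ℝ (TangentSpace 𝓘(ℝ, E) x →L[ℝ] ℝ) := e.finiteDimensional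
    refine (LinearMap.injective_iff_surjective_of_finrank_eq_finrank ?_).1 hinj
    rw [← e.finrank_eq]
    exact Subspace.dual_finrank_eq.symm

/-- The inverse isomorphism `T_x^* M → T_x M`. -/
def sharp (g : Metric E M) (x : M) :
    (TangentSpace 𝓘(ℝ, E) x →L[ℝ] ℝ) ≃ₗ[ℝ] TangentSpace 𝓘(ℝ, E) x := (flat g x).symm

theorem inner_sharp (g : Metric E M) (x : M) (α : TangentSpace 𝓘(ℝ, E) x →L[ℝ] ℝ)
    (w : TangentSpace 𝓘(ℝ, E) x) : g.inner x (sharp g x α) w = α w :=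
  congrArg (fun β : TangentSpace 𝓘(ℝ, E) x →L[ℝ] ℝ ↦ β w) ((flat g x).apply_symm_apply α)

/-- The gradient `∇f`: `df(X) = g(X, ∇f)`. -/
def gradient (g : Metric E M) (f : M → ℝ) : VField E M :=
  fun x ↦ sharp g x (mvfderiv 𝓘(ℝ, E) f x)

/-! ### The Levi-Civita connection -/

/-- Koszul's expression for `g(∇_X Y, W)`. -/
def koszul (g : Metric E M) (X Y W : VField E M) (x : M) : ℝ :=
  (1 / 2) * (derivAlong X (innerFun g Y W) x + derivAlong Y (innerFun g X W) x
    - derivAlong W (innerFun g X Y) x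
    + g.inner x (mlieBracket 𝓘(ℝ, E) X Y x) (W x)
    - g.inner x (mlieBracket 𝓘(ℝ, E) X W x) (Y x)
    - g.inner x (mlieBracket 𝓘(ℝ, E) Y W x) (X x))

theorem mdifferentiableAt_innerFun (g : Metric E M) {X Y : VField E M} {x : M}
    (hX : MDiffAt (T% X) x) (hY : MDiffAt (T% Y) x) : MDiffAt (innerFun g X Y) x := by
  have : MDifferentiableAt 𝓘(ℝ, E) (𝓘(ℝ, E).prod 𝓘(ℝ))
      (fun m ↦ TotalSpace.mk' ℝ (E := Bundle.Trivial M ℝ) m (g.inner m (X m) (Y m))) x := by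
    apply MDifferentiableAt.clm_bundle_apply₂ (F₁ := E) (F₂ := E)
    · exact g.contMDiff.mdifferentiable (by simp) x
    · exact hX
    · exact hY
  simp only [mdifferentiableAt_totalSpace] at this
  exact this.2

theorem tensorialAt_koszul_third (g : Metric E M) {X Y : VField E M} {x : M}
    (hX : MDiffAt (T% X) x) (hY : MDiffAt (T% Y) x) :
    TensorialAt 𝓘(ℝ, E) E (fun W ↦ koszul g X Y W x) x where
  smul {f W} hf hW := by
    have e1 : innerFun g Y (f • W) = f * innerFun g Y W := by
      ext y; simp [innerFun]
    have e2 : innerFun g X (f • W) = f * innerFun g X W := by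
      ext y; simp [innerFun]
    simp only [koszul, derivAlong, e1, e2, mvfderiv_mul hf (mdifferentiableAt_innerFun g hY hW),
      mvfderiv_mul hf (mdifferentiableAt_innerFun g hX hW), mlieBracket_smul_right hf hW]
    simp [innerFun, g.symm x (W x)]
    ring
  add {W W'} hW hW' := by
    have e1 : innerFun g Y (W + W') = innerFun g Y W + innerFun g Y W' := by
      ext y; simp [innerFun]
    have e2 : innerFun g X (W + W') = innerFun g X W + innerFun g X W' := by
      ext y; simp [innerFun]
    simp only [koszul, derivAlong, e1, e2,
      mvfderiv_add (mdifferentiableAt_innerFun g hY hW) (mdifferentiableAt_innerFun g hY hW'),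
      mvfderiv_add (mdifferentiableAt_innerFun g hX hW) (mdifferentiableAt_innerFun g hX hW'),
      mlieBracket_add_right hW hW']
    simp
    ring

theorem tensorialAt_koszul_first (g : Metric E M) {Y W : VField E M} {x : M}
    (hY : MDiffAt (T% Y) x) (hW : MDiffAt (T% W) x) :
    TensorialAt 𝓘(ℝ, E) E (fun X ↦ koszul g X Y W x) x where
  smul {f X} hf hX := by
    have e1 : innerFun g (f • X) W = f * innerFun g X W := by
      ext y; simp [innerFun]
    have e2 : innerFun g (f • X) Y = f * innerFun g X Y := by
      ext y; simp [innerFun]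
    simp only [koszul, derivAlong, e1, e2, mvfderiv_mul hf (mdifferentiableAt_innerFun g hX hW),
      mvfderiv_mul hf (mdifferentiableAt_innerFun g hX hY), mlieBracket_smul_left hf hX]
    simp [innerFun]
    ring
  add {X X'} hX hX' := by
    have e1 : innerFun g (X + X') W = innerFun g X W + innerFun g X' W := by
      ext y; simp [innerFun]
    have e2 : innerFun g (X + X') Y = innerFun g X Y + innerFun g X' Y := by
      ext y; simp [innerFun]
    simp only [koszul, derivAlong, e1, e2,
      mvfderiv_add (mdifferentiableAt_innerFun g hX hW) (mdifferentiableAt_innerFun g hX' hW),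
      mvfderiv_add (mdifferentiableAt_innerFun g hX hY) (mdifferentiableAt_innerFun g hX' hY),
      mlieBracket_add_left hX hX']
    simp
    ring

open Classical in
/-- `v ↦ ∇_v Y` at the point `x`, determined by Koszul's formula (and `0` by convention where `Y`
is not differentiable). -/
def leviCivitaAt (g : Metric E M) (Y : VField E M) (x : M) :
    TangentSpace 𝓘(ℝ, E) x →L[ℝ] TangentSpace 𝓘(ℝ, E) x :=
  if hY : MDiffAt (T% Y) x then
    LinearMap.toContinuousLinearMap ((sharp g x).toLinearMap ∘ₗ
      (TensorialAt.mkHom₂ (I := 𝓘(ℝ, E)) (F := E) (F' := E) (fun X W ↦ koszul g X Y W x) x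
        (fun _ hW ↦ tensorialAt_koszul_first g hY hW)
        (fun _ hX ↦ tensorialAt_koszul_third g hX hY)).toLinearMap)
  else 0

theorem inner_leviCivitaAt (g : Metric E M) {X Y W : VField E M} {x : M}
    (hX : MDiffAt (T% X) x) (hY : MDiffAt (T% Y) x) (hW : MDiffAt (T% W) x) :
    g.inner x (leviCivitaAt g Y x (X x)) (W x) = koszul g X Y W x := by
  rw [leviCivitaAt, dif_pos hY]
  simp only [LinearMap.coe_toContinuousLinearMap', LinearMap.comp_apply, LinearEquiv.coe_coe,
    inner_sharp, ContinuousLinearMap.coe_coe]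
  exact TensorialAt.mkHom₂_apply _ _ hX hW

theorem ext_inner (g : Metric E M) (x : M) {u v : TangentSpace 𝓘(ℝ, E) x}
    (h : ∀ w, g.inner x u w = g.inner x v w) : u = v :=
  (flat g x).injective (ContinuousLinearMap.ext h)

/-- The Levi-Civita connection of `g`; `leviCivita g Y x (X x)` is `∇_X Y` at `x`. -/
def leviCivita (g : Metric E M) :
    CovariantDerivative 𝓘(ℝ, E) E (TangentSpace 𝓘(ℝ, E) : M → Type _) where
  toFun := leviCivitaAt g
  isCovariantDerivativeOnUniv :=
    { add := by
        intro Y Y' x hY hY' _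
        have hYY : MDiffAt (T% (Y + Y')) x := mdifferentiableAt_add_section hY hY'
        ext v
        refine ext_inner g x fun w ↦ ?_
        have hv := FiberBundle.mdifferentiableAt_extend 𝓘(ℝ, E) E v
        have hw := FiberBundle.mdifferentiableAt_extend 𝓘(ℝ, E) E w
        have a := inner_leviCivitaAt g hv hYY hw
        have b := inner_leviCivitaAt g hv hY hw
        have c := inner_leviCivitaAt g hv hY' hw
        simp only [FiberBundle.extend_apply_self] at a b c
        simp only [_root_.add_apply, map_add, a, b, c]
        generalize FiberBundle.extend E v = X at *
        generalize FiberBundle.extend E w = W at *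
        have e1 : innerFun g (Y + Y') W = innerFun g Y W + innerFun g Y' W := by
          ext y; simp [innerFun]
        have e2 : innerFun g X (Y + Y') = innerFun g X Y + innerFun g X Y' := by
          ext y; simp [innerFun]
        simp only [koszul, derivAlong, e1, e2,
          mvfderiv_add (mdifferentiableAt_innerFun g hY hw) (mdifferentiableAt_innerFun g hY' hw),
          mvfderiv_add (mdifferentiableAt_innerFun g hv hY) (mdifferentiableAt_innerFun g hv hY'),
          mlieBracket_add_left hY hY', mlieBracket_add_right hY hY']
        simp
        ring
      leibniz := by
        intro Y f x hY hf _
        have hYY : MDiffAt (T% (f • Y)) x := hf.smul_section hY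
        ext v
        refine ext_inner g x fun w ↦ ?_
        have hv := FiberBundle.mdifferentiableAt_extend 𝓘(ℝ, E) E v
        have hw := FiberBundle.mdifferentiableAt_extend 𝓘(ℝ, E) E w
        have a := inner_leviCivitaAt g hv hYY hw
        have b := inner_leviCivitaAt g hv hY hw
        have ev : FiberBundle.extend E v x = v := FiberBundle.extend_apply_self E v
        have ew : FiberBundle.extend E w x = w := FiberBundle.extend_apply_self E w
        rw [ev, ew] at a b
        simp only [_root_.add_apply, _root_.smul_apply, map_add,
          map_smul, ContinuousLinearMap.smulRight_apply, smul_eq_mul, a, b]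
        generalize FiberBundle.extend E v = X at *
        generalize FiberBundle.extend E w = W at *
        subst ev ew
        have e1 : innerFun g (f • Y) W = f * innerFun g Y W := by
          ext y; simp [innerFun]
        have e2 : innerFun g X (f • Y) = f * innerFun g X Y := by
          ext y; simp [innerFun]
        simp only [koszul, derivAlong, e1, e2,
          mvfderiv_mul hf (mdifferentiableAt_innerFun g hY hw),
          mvfderiv_mul hf (mdifferentiableAt_innerFun g hv hY),
          mlieBracket_smul_left hf hY, mlieBracket_smul_right hf hY]
        simp [innerFun, g.symm x (Y x)]
        ring }

/-- The Levi-Civita connection is torsion-free. -/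
theorem torsion_leviCivita (g : Metric E M) : (leviCivita g).torsion = 0 := by
  rw [CovariantDerivative.torsion_eq_zero_iff]
  intro X Y x hX hY
  refine ext_inner g x fun w ↦ ?_
  have hw := FiberBundle.mdifferentiableAt_extend 𝓘(ℝ, E) E w
  have a := inner_leviCivitaAt g hX hY hw
  have b := inner_leviCivitaAt g hY hX hw
  have ew : FiberBundle.extend E w x = w := FiberBundle.extend_apply_self E w
  have e : innerFun g X Y = innerFun g Y X := by ext y; exact g.symm y _ _
  rw [ew] at a b
  change g.inner x (leviCivitaAt g Y x (X x) - leviCivitaAt g X x (Y x)) w = _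
  rw [map_sub, _root_.sub_apply, a, b]
  simp only [koszul, e, ew, mlieBracket_swap_apply (V := Y) (W := X), map_neg,
    _root_.neg_apply]
  ring

/-- The Levi-Civita connection is compatible with the metric. -/
theorem derivAlong_innerFun_leviCivita (g : Metric E M) {X Y W : VField E M} {x : M}
    (hX : MDiffAt (T% X) x) (hY : MDiffAt (T% Y) x) (hW : MDiffAt (T% W) x) :
    derivAlong X (innerFun g Y W) x =
      g.inner x (leviCivita g Y x (X x)) (W x) + g.inner x (Y x) (leviCivita g W x (X x)) := by
  change _ = g.inner x (leviCivitaAt g Y x (X x)) (W x) +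
    g.inner x (Y x) (leviCivitaAt g W x (X x))
  have e (A B : VField E M) : innerFun g A B = innerFun g B A := by ext y; exact g.symm y _ _
  rw [g.symm x (Y x), inner_leviCivitaAt g hX hY hW, inner_leviCivitaAt g hX hW hY]
  simp only [koszul, e W Y, e X Y, e X W, mlieBracket_swap_apply (V := W) (W := Y), map_neg,
    _root_.neg_apply]
  ring

/-! ### One-dimensional foliations

A nowhere vanishing smooth vector field `Z` spans a line subbundle `V` of `TM`. It has rank one,
hence is involutive, and is tangent to a foliation by curves. -/

/-- The fibre `V_x`, the line spanned by `Z`. -/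
def vertical (Z : VField E M) (x : M) : Submodule ℝ (TangentSpace 𝓘(ℝ, E) x) :=
  Submodule.span ℝ {Z x}

/-- The fibre `D_x`, the `g`-orthogonal complement of `V_x`. -/
def horizontal (g : Metric E M) (Z : VField E M) (x : M) :
    Submodule ℝ (TangentSpace 𝓘(ℝ, E) x) :=
  LinearMap.ker (g.inner x (Z x)).toLinearMap

/-- The `g`-orthogonal projection of `T_x M` onto `V_x = ℝ Z_x`, `v ↦ g(Z, v) / g(Z, Z) Z`. -/
def prV (g : Metric E M) (Z : VField E M) (x : M) :
    TangentSpace 𝓘(ℝ, E) x →L[ℝ] TangentSpace 𝓘(ℝ, E) x :=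
  ((g.inner x (Z x) (Z x))⁻¹ • g.inner x (Z x)).smulRight (Z x)

/-- The `g`-orthogonal projection of `T_x M` onto `V_x^⊥`. -/
def prD (g : Metric E M) (Z : VField E M) (x : M) :
    TangentSpace 𝓘(ℝ, E) x →L[ℝ] TangentSpace 𝓘(ℝ, E) x :=
  ContinuousLinearMap.id ℝ _ - prV g Z x

/-- The second fundamental form of the leaves, `II(A, B) = pr_D ∇_{pr_V A} pr_V B`, where `∇` and
the projections are those of `g`. -/
def secondFundamentalForm (g : Metric E M) (Z : VField E M) (A B : VField E M) : VField E M :=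
  fun x ↦ prD g Z x (leviCivita g (fun y ↦ prV g Z y (B y)) x (prV g Z x (A x)))

/-- The leaves are totally geodesic submanifolds of `(M, g)`: their second fundamental form
vanishes. -/
def IsTotallyGeodesic (g : Metric E M) (Z : VField E M) : Prop :=
  ∀ A B : VField E M, IsSmoothField A → IsSmoothField B →
    ∀ x, secondFundamentalForm g Z A B x = 0

/-- The mean curvature vector field `N = II(Z, Z)` of the leaves (for `Z` of unit length). -/
def meanCurvature (g : Metric E M) (Z : VField E M) : VField E M :=
  secondFundamentalForm g Z Z Z

/-- The Lie derivative `(L_Y T)(A, B) = Y T(A, B) - T([Y, A], B) - T(A, [Y, B])` of a covariant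
two-tensor. -/
def lieDerivative (T : Π x : M, TangentSpace 𝓘(ℝ, E) x → TangentSpace 𝓘(ℝ, E) x → ℝ)
    (Y A B : VField E M) (x : M) : ℝ :=
  derivAlong Y (fun y ↦ T y (A y) (B y)) x
    - T x (mlieBracket 𝓘(ℝ, E) Y A x) (B x) - T x (A x) (mlieBracket 𝓘(ℝ, E) Y B x)

/-- The tensor `pr_D^* g`. -/
def transverseMetric (g : Metric E M) (Z : VField E M) (x : M)
    (v w : TangentSpace 𝓘(ℝ, E) x) : ℝ :=
  g.inner x (prD g Z x v) (prD g Z x w)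

/-- The foliation is Riemannian: `L_Y pr_D^* g = 0` for every smooth section `Y` of `V`. -/
def IsRiemannianFoliation (g : Metric E M) (Z : VField E M) : Prop :=
  ∀ Y : VField E M, IsSmoothField Y → (∀ x, Y x ∈ vertical Z x) →
    ∀ A B : VField E M, IsSmoothField A → IsSmoothField B →
      ∀ x, lieDerivative (transverseMetric g Z) Y A B x = 0

/-- The curvature of `D` as an operation on vector fields, `ℛ(X, Y) = pr_V [pr_D X, pr_D Y]`. -/
def curvature (g : Metric E M) (Z : VField E M) (X Y : VField E M) : VField E M :=
  fun x ↦ prV g Z x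
    (mlieBracket 𝓘(ℝ, E) (fun y ↦ prD g Z y (X y)) (fun y ↦ prD g Z y (Y y)) x)

/-- The curvature of `D` as a tensor: its value on tangent vectors at `x` is computed with the
extensions of these vectors that are constant in the preferred chart at `x`, which does not matter
by `curvatureAt_apply`. -/
def curvatureAt (g : Metric E M) (Z : VField E M) (x : M)
    (v w : TangentSpace 𝓘(ℝ, E) x) : TangentSpace 𝓘(ℝ, E) x :=
  curvature g Z (FiberBundle.extend E v) (FiberBundle.extend E w) x

theorem mdifferentiableAt_prD (g : Metric E M) {Z X : VField E M} {x : M}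
    (hZ : MDiffAt (T% Z) x) (hZx : Z x ≠ 0) (hX : MDiffAt (T% X) x) :
    MDiffAt (T% (fun y ↦ prD g Z y (X y))) x := by
  have h1 := mdifferentiableAt_innerFun g hZ hZ
  have h2 := mdifferentiableAt_innerFun g hZ hX
  have h0 : innerFun g Z Z x ≠ 0 := (g.pos x (Z x) hZx).ne'
  have h3 : MDiffAt (fun y ↦ - ((innerFun g Z Z y)⁻¹ * innerFun g Z X y)) x := by
    exact ((h1.inv h0).mul h2).neg
  have h4 := mdifferentiableAt_add_section hX (h3.smul_section hZ)
  convert! h4 using 3 with y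
  simp [prD, prV, innerFun, sub_eq_add_neg]

theorem prV_prD (g : Metric E M) (Z : VField E M) (x : M) (v : TangentSpace 𝓘(ℝ, E) x) :
    prV g Z x (prD g Z x v) = 0 := by
  by_cases h : Z x = 0
  · simp [prV, h]
  · have := (g.pos x (Z x) h).ne'
    simp [prV, prD]
    field_simp
    simp

theorem tensorialAt_curvature_second (g : Metric E M) {Z X : VField E M} {x : M}
    (hZ : MDiffAt (T% Z) x) (hZx : Z x ≠ 0) :
    TensorialAt 𝓘(ℝ, E) E (fun Y ↦ curvature g Z X Y x) x where
  smul {f Y} hf hY := by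
    have e : (fun y ↦ prD g Z y ((f • Y) y)) = f • (fun y ↦ prD g Z y (Y y)) := by
      ext y; simp
    simp only [curvature]
    rw [e, mlieBracket_smul_right hf (mdifferentiableAt_prD g hZ hZx hY)]
    simp [prV_prD]
  add {Y Y'} hY hY' := by
    have e : (fun y ↦ prD g Z y ((Y + Y') y)) =
        (fun y ↦ prD g Z y (Y y)) + (fun y ↦ prD g Z y (Y' y)) := by
      ext y; simp
    simp only [curvature]
    rw [e, mlieBracket_add_right (mdifferentiableAt_prD g hZ hZx hY)
      (mdifferentiableAt_prD g hZ hZx hY')]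
    simp

theorem curvature_swap (g : Metric E M) (Z X Y : VField E M) (x : M) :
    curvature g Z X Y x = - curvature g Z Y X x := by
  simp only [curvature]
  rw [mlieBracket_swap_apply, map_neg]

theorem tensorialAt_curvature_first (g : Metric E M) {Z Y : VField E M} {x : M}
    (hZ : MDiffAt (T% Z) x) (hZx : Z x ≠ 0) :
    TensorialAt 𝓘(ℝ, E) E (fun X ↦ curvature g Z X Y x) x where
  smul {f X} hf hX := by
    have := (tensorialAt_curvature_second g (X := Y) hZ hZx).smul hf hX
    simp only [curvature_swap g Z _ Y, this, smul_neg]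
  add {X X'} hX hX' := by
    have := (tensorialAt_curvature_second g (X := Y) hZ hZx).add hX hX'
    simp only [curvature_swap g Z _ Y, this, neg_add]

theorem curvatureAt_apply (g : Metric E M) {Z X Y : VField E M} {x : M}
    (hZ : MDiffAt (T% Z) x) (hZx : Z x ≠ 0) (hX : MDiffAt (T% X) x) (hY : MDiffAt (T% Y) x) :
    curvatureAt g Z x (X x) (Y x) = curvature g Z X Y x :=
  TensorialAt.mkHom₂_apply (I := 𝓘(ℝ, E)) (F := E) (F' := E)
    (Φ := fun X Y ↦ curvature g Z X Y x)
    (fun _ _ ↦ tensorialAt_curvature_first g hZ hZx)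
    (fun _ _ ↦ tensorialAt_curvature_second g hZ hZx) hX hY

variable (E) in
/-- A basis of `T_x M`. -/
def tangentBasis (x : M) :
    Module.Basis (Fin (Module.finrank ℝ E)) ℝ (TangentSpace 𝓘(ℝ, E) x) :=
  Module.finBasis ℝ E

/-- The matrix `g_{ij}` of the metric at `x` in the basis `e_1, …, e_n = tangentBasis E x`. -/
def gram (g : Metric E M) (x : M) :
    Matrix (Fin (Module.finrank ℝ E)) (Fin (Module.finrank ℝ E)) ℝ :=
  Matrix.of fun i j ↦ g.inner x (tangentBasis E x i) (tangentBasis E x j)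

/-- The norm `‖ℛ‖` of the vector-valued two-form `ℛ` induced by `g`, with the inverse matrix
`g^{ij}` of `g_{ij}`: `‖ℛ‖² = 1/2 ∑ g^{ik} g^{jl} g(ℛ(e_i, e_j), ℛ(e_k, e_l))`, that is, the sum of
`g(ℛ(u_i, u_j), ℛ(u_i, u_j))` over `i < j` for any `g`-orthonormal basis `u` of `T_x M`. -/
def curvatureNorm (g : Metric E M) (Z : VField E M) (x : M) : ℝ :=
  Real.sqrt ((1 / 2) * ∑ i, ∑ j, ∑ k, ∑ l, (gram g x)⁻¹ i k * (gram g x)⁻¹ j l *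
    g.inner x (curvatureAt g Z x (tangentBasis E x i) (tangentBasis E x j))
      (curvatureAt g Z x (tangentBasis E x k) (tangentBasis E x l)))

/-- The horizontal gradient `∇^D f`: `df(pr_D X) = g(X, ∇^D f)`. -/
def horizontalGradient (g : Metric E M) (Z : VField E M) (f : M → ℝ) : VField E M :=
  fun x ↦ sharp g x ((mvfderiv 𝓘(ℝ, E) f x).comp (prD g Z x))

end

end LineFoliation

end

/-! Write `η = g₀(Z, ·)`. If `D` and `V` are `g`-orthogonal, then `g(Z, ·) = e^{2h} η` for a smooth
`h`, and the `g`-orthogonal projections are those of `g₀`. Koszul's formula for `∇_Z Z` against a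
horizontal field involves only `g(Z, ·)`, so the leaves are totally geodesic for `g` exactly when `N
= ∇^D h` (`isTotallyGeodesic_iff_meanCurvature`). It remains to compare `h` with `log ‖ℛ‖`.

Suppose `N = ∇^D h` and put `ψ = e^{-h}`. Then `[ψZ, W]` is horizontal for every horizontal `W`, so
`ψZ` preserves the splitting and the one-form `θ = ψ⁻¹ η`. By the Jacobi identity it also preserves
the two-form `Ω = θ([pr_D ·, pr_D ·])`. Since the foliation is Riemannian, the Lie derivative of
`g₀` along `ψZ` is a multiple of `η ⊗ η`, which the norm of `Ω` does not see because `Z` lies in the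
kernel of `Ω`. Hence `‖Ω‖ = ψ⁻¹ ‖ℛ‖` is constant along the leaves
(`IsScaling.mvfderiv_log_curvatureNorm`), that is, `Z (h + log ‖ℛ‖) = 0`. For `f = h + log ‖ℛ‖` this
gives `∇f = ∇^D f`, and `N = ∇^D h` becomes the required identity.

Conversely, `N` is horizontal, so pairing the identity with `Z` gives `Z f = 0`. Then `h = f - log
‖ℛ‖` satisfies `N = ∇^D h`, and the conformal metric `e^{2h} g₀` has the required properties. -/

noncomputable section

namespace LineFoliation

/-! ### Norm of a two-form in matrix terms. -/

section MatrixAlgebra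

variable {n : Type*} [Fintype n] [DecidableEq n]

/-- Twice the squared norm of the two-form with matrix `Ω` with respect to the metric with
matrix `G`. -/
def formNormSq (G Ω : Matrix n n ℝ) : ℝ := (G⁻¹ * Ω * G⁻¹ * Ω.transpose).trace

theorem formNormSq_smul (G Ω : Matrix n n ℝ) (c : ℝ) :
    formNormSq G (c • Ω) = c ^ 2 * formNormSq G Ω := by
  simp [formNormSq, Matrix.trace_smul]
  ring

/-- Independence of the basis: `G⁻¹ Ω` and `G⁻¹ Ωᵀ` are both conjugated by `P`, and the trace of
their product is unchanged. -/
theorem formNormSq_congr {G Ω P : Matrix n n ℝ} (hP : IsUnit P.det) :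
    formNormSq (P.transpose * G * P) (P.transpose * Ω * P) = formNormSq G Ω := by
  have hPt : IsUnit P.transpose.det := by rwa [Matrix.det_transpose]
  have key : (P.transpose * G * P)⁻¹ = P⁻¹ * G⁻¹ * P.transpose⁻¹ := by
    simp only [Matrix.mul_inv_rev, Matrix.mul_assoc]
  have e : (P.transpose * G * P)⁻¹ * (P.transpose * Ω * P) = P⁻¹ * (G⁻¹ * Ω * P) := by
    rw [key]
    simp only [Matrix.mul_assoc]
    rw [Matrix.nonsing_inv_mul_cancel_left _ _ hPt]
  have e' : (P.transpose * G * P)⁻¹ * (P.transpose * Ω * P).transpose =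
      P⁻¹ * (G⁻¹ * Ω.transpose * P) := by
    rw [key]
    simp only [Matrix.mul_assoc, Matrix.transpose_mul, Matrix.transpose_transpose]
    rw [Matrix.nonsing_inv_mul_cancel_left _ _ hPt]
  unfold formNormSq
  rw [Matrix.mul_assoc (_ * _), e, e', Matrix.mul_assoc P⁻¹, Matrix.trace_mul_comm]
  simp only [Matrix.mul_assoc]
  rw [Matrix.mul_nonsing_inv _ hP, Matrix.mul_nonsing_inv_cancel_left _ _ hP, Matrix.mul_one]

-- Factoring `G⁻¹ = Bᵀ B` turns the expression into the squared Frobenius norm of `B Ω Bᵀ`, that is,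
-- passes to an orthonormal basis.
open scoped MatrixOrder Matrix.Norms.L2Operator in
theorem formNormSq_pos {G Ω : Matrix n n ℝ} (hG : G.PosDef) (hΩ : Ω ≠ 0) :
    0 < formNormSq G Ω := by
  obtain ⟨B, hB, hGB⟩ : ∃ B : Matrix n n ℝ, IsUnit B.det ∧ G⁻¹ = B.transpose * B := by
    obtain ⟨B, hB⟩ := CStarAlgebra.nonneg_iff_eq_star_mul_self.mp hG.inv.posSemidef.nonneg
    refine ⟨B, ?_, by simpa [Matrix.star_eq_conjTranspose] using hB⟩
    have h : IsUnit (star B * B).det := by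
      rw [← hB, ← Matrix.isUnit_iff_isUnit_det]; exact hG.inv.isUnit
    rw [Matrix.det_mul] at h
    exact isUnit_of_mul_isUnit_right h
  have hBt : IsUnit B.transpose.det := by rwa [Matrix.det_transpose]
  set C := B * Ω * B.transpose with hC
  have e : formNormSq G Ω = (C.transpose * C).trace := by
    rw [formNormSq, hGB, Matrix.trace_mul_comm C.transpose, hC]
    simp only [Matrix.transpose_mul, Matrix.transpose_transpose, Matrix.mul_assoc]
    rw [Matrix.trace_mul_comm]
    simp only [Matrix.mul_assoc]
  have hC0 : C ≠ 0 := by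
    intro h
    apply hΩ
    have h1 : B⁻¹ * C * B.transpose⁻¹ = Ω := by
      rw [hC, Matrix.mul_assoc B, Matrix.nonsing_inv_mul_cancel_left _ _ hB,
        Matrix.mul_nonsing_inv_cancel_right _ _ hBt]
    rw [← h1, h]; simp
  rw [e]
  refine lt_of_le_of_ne ?_ fun h ↦ hC0 ?_
  · simpa using (Matrix.posSemidef_conjTranspose_mul_self C).trace_nonneg
  · exact Matrix.trace_conjTranspose_mul_self_eq_zero_iff.mp (by simpa using h.symm)

/-- Infinitesimal invariance of `formNormSq`: if `G` and `Ω` vary by the infinitesimal change of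
basis `C`, up to a multiple of the square of a covector `η` dual to the kernel of `Ω`, then the
derivative of `formNormSq G Ω` vanishes. -/
theorem trace_derivative_eq_zero {G Ω G' H' Ω' C : Matrix n n ℝ} {η : n → ℝ} {c : ℝ}
    (hG : IsUnit G.det) (hH' : H' * G + G⁻¹ * G' = 0)
    (hG' : G' = c • Matrix.vecMulVec η η + C * G + G * C.transpose)
    (hΩ' : Ω' = C * Ω + Ω * C.transpose)
    (hη : Matrix.vecMul η (G⁻¹ * Ω) = 0) (hη' : Matrix.vecMul η (G⁻¹ * Ω.transpose) = 0) :
    (H' * Ω * G⁻¹ * Ω.transpose + G⁻¹ * Ω' * G⁻¹ * Ω.transpose + G⁻¹ * Ω * H' * Ω.transpose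
      + G⁻¹ * Ω * G⁻¹ * Ω'.transpose).trace = 0 := by
  -- `H'` is the derivative of `G⁻¹`, so `H' = -G⁻¹ G' G⁻¹`.
  have hL : H' = - (c • (G⁻¹ * Matrix.vecMulVec η η * G⁻¹)) - G⁻¹ * C - C.transpose * G⁻¹ := by
    have h1 : H' * G * G⁻¹ = - (G⁻¹ * G') * G⁻¹ := by rw [eq_neg_of_add_eq_zero_left hH']
    rw [Matrix.mul_nonsing_inv_cancel_right _ _ hG] at h1
    rw [h1, hG']
    simp only [Matrix.mul_add, Matrix.add_mul, Matrix.neg_mul, Matrix.mul_smul, Matrix.smul_mul]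
    rw [← Matrix.mul_assoc G⁻¹ G, Matrix.nonsing_inv_mul _ hG, Matrix.one_mul,
      ← Matrix.mul_assoc G⁻¹ C, Matrix.mul_nonsing_inv_cancel_right _ _ hG]
    abel
  have z1 : Matrix.vecMulVec η η * (G⁻¹ * Ω) = 0 := by
    rw [Matrix.vecMulVec_mul, hη]; ext; simp [Matrix.vecMulVec]
  have z2 : Matrix.vecMulVec η η * (G⁻¹ * Ω.transpose) = 0 := by
    rw [Matrix.vecMulVec_mul, hη']; ext; simp [Matrix.vecMulVec]
  have a1 : H' * Ω = - (G⁻¹ * C * Ω) - C.transpose * G⁻¹ * Ω := by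
    rw [hL]
    simp only [Matrix.sub_mul, Matrix.neg_mul, Matrix.smul_mul, Matrix.mul_assoc, z1]
    simp
  have a2 : H' * Ω.transpose = - (G⁻¹ * C * Ω.transpose) - C.transpose * G⁻¹ * Ω.transpose := by
    rw [hL]
    simp only [Matrix.sub_mul, Matrix.neg_mul, Matrix.smul_mul, Matrix.mul_assoc, z2]
    simp
  rw [a1, Matrix.mul_assoc (G⁻¹ * Ω) H', a2, hΩ']
  simp only [Matrix.transpose_add, Matrix.transpose_mul, Matrix.transpose_transpose,
    Matrix.mul_add, Matrix.add_mul, Matrix.mul_sub, Matrix.sub_mul, Matrix.neg_mul,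
    Matrix.mul_neg, Matrix.trace_add, Matrix.trace_sub, Matrix.trace_neg, Matrix.mul_assoc]
  -- All terms cancel in pairs as written, except the two with `Cᵀ` at the far left and the far
  -- right, which agree after a cyclic permutation.
  rw [Matrix.trace_mul_comm C.transpose]
  simp only [Matrix.mul_assoc]
  ring

end MatrixAlgebra

/-! ### Smoothness of matrix functions and fields, and local frames by global fields. -/

section Smoothness

variable {E : Type*} [NormedAddCommGroup E] [NormedSpace ℝ E]
  {M : Type*} [TopologicalSpace M] [ChartedSpace E M]

section Matrix

variable {n : Type*} [Fintype n] [DecidableEq n] {k : ℕ∞ω} {x : M}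

theorem contMDiffAt_matrix_det {G : M → Matrix n n ℝ}
    (hG : ∀ i j, ContMDiffAt 𝓘(ℝ, E) 𝓘(ℝ) k (fun y ↦ G y i j) x) :
    ContMDiffAt 𝓘(ℝ, E) 𝓘(ℝ) k (fun y ↦ (G y).det) x := by
  simp only [Matrix.det_apply']
  exact ContMDiffAt.sum fun σ _ ↦ contMDiffAt_const.mul (contMDiffAt_finsetProd fun i _ ↦ hG _ _)

/-- Cramer's rule: the adjugate entries are determinants, hence polynomial in the entries of `G`. -/
theorem contMDiffAt_matrix_inv {G : M → Matrix n n ℝ}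
    (hG : ∀ i j, ContMDiffAt 𝓘(ℝ, E) 𝓘(ℝ) k (fun y ↦ G y i j) x) (h0 : (G x).det ≠ 0) (i j : n) :
    ContMDiffAt 𝓘(ℝ, E) 𝓘(ℝ) k (fun y ↦ (G y)⁻¹ i j) x := by
  have h1 : ContMDiffAt 𝓘(ℝ, E) 𝓘(ℝ) k (fun y ↦ (G y).adjugate i j) x := by
    simp only [Matrix.adjugate_apply]
    refine contMDiffAt_matrix_det fun a b ↦ ?_
    by_cases h : a = j
    · subst h; simpa using contMDiffAt_const
    · simpa [Matrix.updateRow_ne h] using hG a b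
  have h2 := ((contMDiffAt_matrix_det hG).inv₀ h0).mul h1
  simpa [Matrix.inv_def, Pi.mul_def] using h2

end Matrix

variable [IsManifold 𝓘(ℝ, E) ∞ M]

theorem contMDiffAt_innerFun (g : Metric E M) {X Y : VField E M} {x : M}
    (hX : ContMDiffAt 𝓘(ℝ, E) (𝓘(ℝ, E).prod 𝓘(ℝ, E)) ∞ (T% X) x)
    (hY : ContMDiffAt 𝓘(ℝ, E) (𝓘(ℝ, E).prod 𝓘(ℝ, E)) ∞ (T% Y) x) :
    ContMDiffAt 𝓘(ℝ, E) 𝓘(ℝ) ∞ (innerFun g X Y) x := by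
  have : ContMDiffAt 𝓘(ℝ, E) (𝓘(ℝ, E).prod 𝓘(ℝ)) ∞
      (fun m ↦ TotalSpace.mk' ℝ (E := Bundle.Trivial M ℝ) m (g.inner m (X m) (Y m))) x := by
    apply ContMDiffAt.clm_bundle_apply₂ (F₁ := E) (F₂ := E)
    · exact g.contMDiff x
    · exact hX
    · exact hY
  simp only [contMDiffAt_totalSpace] at this
  exact this.2

theorem contMDiff_innerFun (g : Metric E M) {X Y : VField E M} (hX : IsSmoothField X)
    (hY : IsSmoothField Y) : ContMDiff 𝓘(ℝ, E) 𝓘(ℝ) ∞ (innerFun g X Y) :=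
  fun x ↦ contMDiffAt_innerFun g (hX x) (hY x)

theorem IsSmoothField.mdiffAt {X : VField E M} (hX : IsSmoothField X) (x : M) :
    MDiffAt (T% X) x := (hX x).mdifferentiableAt (by simp)

theorem IsSmoothField.smul {X : VField E M} {f : M → ℝ} (hf : ContMDiff 𝓘(ℝ, E) 𝓘(ℝ) ∞ f)
    (hX : IsSmoothField X) : IsSmoothField (f • X) := ContMDiff.smul_section hf hX

theorem IsSmoothField.sub {X Y : VField E M} (hX : IsSmoothField X) (hY : IsSmoothField Y) :
    IsSmoothField (X - Y) := ContMDiff.sub_section hX hY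

variable [FiniteDimensional ℝ E]

theorem IsSmoothField.mlieBracket {X Y : VField E M} (hX : IsSmoothField X)
    (hY : IsSmoothField Y) : IsSmoothField (mlieBracket 𝓘(ℝ, E) X Y) := by
  have := FiniteDimensional.complete ℝ E
  have : IsManifold 𝓘(ℝ, E) (((⊤ : ℕ∞) : ℕ∞ω) + 1) M := inferInstanceAs (IsManifold 𝓘(ℝ, E) ∞ M)
  have : IsManifold 𝓘(ℝ, E) (minSmoothness ℝ 2) M :=
    IsManifold.of_le (n := ∞) (by simpa using ENat.LEInfty.out)
  exact ContDiff.mlieBracket_vectorField (m := ⊤) (n := ⊤) hX hY (by simp)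

theorem mlieBracket_leibniz {U V W : VField E M} (hU : IsSmoothField U)
    (hV : IsSmoothField V) (hW : IsSmoothField W) (x : M) :
    VectorField.mlieBracket 𝓘(ℝ, E) U (VectorField.mlieBracket 𝓘(ℝ, E) V W) x =
      VectorField.mlieBracket 𝓘(ℝ, E) (VectorField.mlieBracket 𝓘(ℝ, E) U V) W x
        + VectorField.mlieBracket 𝓘(ℝ, E) V (VectorField.mlieBracket 𝓘(ℝ, E) U W) x := by
  have := FiniteDimensional.complete ℝ E
  have h2 : minSmoothness ℝ 2 ≤ (∞ : ℕ∞ω) := by simpa using ENat.LEInfty.out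
  have : IsManifold 𝓘(ℝ, E) (minSmoothness ℝ 3) M :=
    IsManifold.of_le (n := ∞) (by simpa using ENat.LEInfty.out)
  exact leibniz_identity_mlieBracket_apply ((hU x).of_le h2) ((hV x).of_le h2) ((hW x).of_le h2)

/-- A local frame of the trivialization is multiplied by a bump function equal to `1` near `x₀`. The
fields are then defined and smooth on all of `M`, as the hypotheses on smooth fields require, and
still form a basis near `x₀`. -/
theorem exists_smooth_frame [T2Space M] (x₀ : M) :
    ∃ X : Fin (Module.finrank ℝ E) → VField E M, (∀ i, IsSmoothField (X i)) ∧
      ∀ᶠ x in nhds x₀, ∃ b : Module.Basis (Fin (Module.finrank ℝ E)) ℝ (TangentSpace 𝓘(ℝ, E) x),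
        ∀ i, b i = X i x := by
  let e := trivializationAt E (TangentSpace 𝓘(ℝ, E) : M → Type _) x₀
  have hx₀ : x₀ ∈ e.baseSet := FiberBundle.mem_baseSet_trivializationAt' x₀
  have hn : e.baseSet ∈ nhds x₀ := e.open_baseSet.mem_nhds hx₀
  let b := Module.finBasis ℝ E
  obtain ⟨ψ, hψ, -⟩ := (SmoothBumpFunction.nhds_basis_support (I := 𝓘(ℝ, E)) hn).mem_iff.1 hn
  refine ⟨fun i ↦ (ψ : M → ℝ) • e.localFrame b i, fun i ↦ ?_, ?_⟩
  · exact ContMDiffOn.smul_section_of_tsupport ψ.contMDiff.contMDiffOn e.open_baseSet hψ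
      (e.contMDiffOn_localFrame_baseSet (n := ∞) (I := 𝓘(ℝ, E)) b i)
  · filter_upwards [hn, ψ.eventuallyEq_one] with x hx hx1
    refine ⟨e.basisAt b hx, fun i ↦ ?_⟩
    simp [hx1, e.localFrame_apply_of_mem_baseSet b hx]

theorem exists_smooth_extension [T2Space M] {x₀ : M} (v : TangentSpace 𝓘(ℝ, E) x₀) :
    ∃ X : VField E M, IsSmoothField X ∧ X x₀ = v := by
  obtain ⟨X, hX, hb⟩ := exists_smooth_frame (E := E) x₀
  obtain ⟨b, hb⟩ := hb.self_of_nhds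
  refine ⟨fun x ↦ ∑ i, b.repr v i • X i x, ?_, ?_⟩
  · exact ContMDiff.sum_section fun i _ ↦ ContMDiff.const_smul_section (hX i)
  · simp only [← hb, b.sum_repr]

end Smoothness

/-! ### The curvature of `D` as a scalar two-form, and its norm in a frame. -/

section CurvatureNorm

variable {E : Type*} [NormedAddCommGroup E] [NormedSpace ℝ E] [FiniteDimensional ℝ E]
  {M : Type*} [TopologicalSpace M] [ChartedSpace E M] [IsManifold 𝓘(ℝ, E) ∞ M]

theorem prV_apply_of_unit (g : Metric E M) {Z : VField E M} {x : M}
    (hunit : g.inner x (Z x) (Z x) = 1) (v : TangentSpace 𝓘(ℝ, E) x) :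
    prV g Z x v = g.inner x (Z x) v • Z x := by
  simp [prV, hunit]

theorem prD_apply_of_unit (g : Metric E M) {Z : VField E M} {x : M}
    (hunit : g.inner x (Z x) (Z x) = 1) (v : TangentSpace 𝓘(ℝ, E) x) :
    prD g Z x v = v - g.inner x (Z x) v • Z x := by
  simp [prD, prV_apply_of_unit g hunit]

theorem ne_zero_of_unit (g : Metric E M) {Z : VField E M} {x : M}
    (hunit : g.inner x (Z x) (Z x) = 1) : Z x ≠ 0 := by
  intro h
  simp [h] at hunit

theorem IsSmoothField.prD (g : Metric E M) {Z X : VField E M} (hZ : IsSmoothField Z)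
    (hunit : ∀ x, g.inner x (Z x) (Z x) = 1) (hX : IsSmoothField X) :
    IsSmoothField (fun x ↦ prD g Z x (X x)) := by
  have h := hX.sub (hZ.smul (contMDiff_innerFun g hZ hX))
  convert! h using 1
  ext x
  simp [prD_apply_of_unit g (hunit x), innerFun]

/-- The metric at `x` as a bilinear form. -/
def metricForm (g : Metric E M) (x : M) : LinearMap.BilinForm ℝ (TangentSpace 𝓘(ℝ, E) x) :=
  LinearMap.mk₂ ℝ (fun v w ↦ g.inner x v w) (by simp) (by simp) (by simp) (by simp)

@[simp]
theorem metricForm_apply (g : Metric E M) (x : M) (v w : TangentSpace 𝓘(ℝ, E) x) :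
    metricForm g x v w = g.inner x v w := rfl

theorem posDef_metricForm_toMatrix (g : Metric E M) {x : M} {n : Type*} [Fintype n] [DecidableEq n]
    (b : Module.Basis n ℝ (TangentSpace 𝓘(ℝ, E) x)) :
    ((metricForm g x).toMatrix b).PosDef := by
  rw [← LinearMap.BilinForm.posDef_toQuadraticMap_iff_matrix b _ ⟨fun v w ↦ g.symm x v w⟩]
  exact fun v hv ↦ g.pos x v hv

/-- The component of the curvature of `D` along the unit field `Z`, as a bilinear form. -/
def curvatureForm (g : Metric E M) {Z : VField E M} {x : M} (hZ : MDiffAt (T% Z) x)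
    (hZx : Z x ≠ 0) : LinearMap.BilinForm ℝ (TangentSpace 𝓘(ℝ, E) x) :=
  let B := TensorialAt.mkHom₂ (I := 𝓘(ℝ, E)) (F := E) (F' := E) (fun X Y ↦ curvature g Z X Y x) x
    (fun _ _ ↦ tensorialAt_curvature_first g hZ hZx)
    (fun _ _ ↦ tensorialAt_curvature_second g hZ hZx)
  LinearMap.mk₂ ℝ (fun v w ↦ g.inner x (Z x) (B v w)) (by simp) (by simp) (by simp) (by simp)

theorem curvatureForm_apply (g : Metric E M) {Z : VField E M} {x : M} (hZ : MDiffAt (T% Z) x)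
    (hZx : Z x ≠ 0) (v w : TangentSpace 𝓘(ℝ, E) x) :
    curvatureForm g hZ hZx v w = g.inner x (Z x) (curvatureAt g Z x v w) := rfl

/-- Since `V` has rank one, the vector-valued form `ℛ` carries the same information as a scalar
two-form. -/
theorem curvatureAt_eq_smul (g : Metric E M) {Z : VField E M} {x : M} (hZ : MDiffAt (T% Z) x)
    (hunit : g.inner x (Z x) (Z x) = 1) (v w : TangentSpace 𝓘(ℝ, E) x) :
    curvatureAt g Z x v w = curvatureForm g hZ (ne_zero_of_unit g hunit) v w • Z x := by
  simp [curvatureForm_apply, curvatureAt, curvature, prV_apply_of_unit g hunit, hunit]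

theorem curvatureForm_field (g : Metric E M) {Z X Y : VField E M} {x : M} (hZ : MDiffAt (T% Z) x)
    (hunit : g.inner x (Z x) (Z x) = 1) (hX : MDiffAt (T% X) x) (hY : MDiffAt (T% Y) x) :
    curvatureForm g hZ (ne_zero_of_unit g hunit) (X x) (Y x) =
      g.inner x (Z x) (mlieBracket 𝓘(ℝ, E) (fun y ↦ prD g Z y (X y))
        (fun y ↦ prD g Z y (Y y)) x) := by
  rw [curvatureForm_apply, curvatureAt_apply g hZ (ne_zero_of_unit g hunit) hX hY]
  simp [curvature, prV_apply_of_unit g hunit, hunit]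

/-- The norm is defined through the fixed family `tangentBasis`, which need not vary smoothly with
`x`. Allowing any basis makes it possible to differentiate the norm in a smooth frame. -/
theorem curvatureNorm_eq_sqrt (g : Metric E M) {Z : VField E M} {x : M} (hZ : MDiffAt (T% Z) x)
    (hunit : g.inner x (Z x) (Z x) = 1)
    (b : Module.Basis (Fin (Module.finrank ℝ E)) ℝ (TangentSpace 𝓘(ℝ, E) x)) :
    curvatureNorm g Z x = Real.sqrt ((1 / 2) * formNormSq ((metricForm g x).toMatrix b)
      ((curvatureForm g hZ (ne_zero_of_unit g hunit)).toMatrix b)) := by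
  set c := tangentBasis E x with hc
  rw [← LinearMap.BilinForm.toMatrix_mul_basis_toMatrix c b,
    ← LinearMap.BilinForm.toMatrix_mul_basis_toMatrix c b, formNormSq_congr, curvatureNorm]
  · congr 2
    have hG : gram g x = (metricForm g x).toMatrix c := by
      ext i j; simp [gram, hc, LinearMap.BilinForm.toMatrix_apply]
    -- The trace produces the entry `g^{lj}` where the definition of the norm has `g^{jl}`.
    have hs : (gram g x)⁻¹.transpose = (gram g x)⁻¹ := by
      rw [Matrix.transpose_nonsing_inv]
      congr 1
      ext i j
      simp [gram, g.symm x (tangentBasis E x j)]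
    rw [← hG]
    simp only [curvatureAt_eq_smul g hZ hunit, formNormSq, Matrix.trace, Matrix.diag,
      Matrix.mul_apply, Matrix.transpose_apply, LinearMap.BilinForm.toMatrix_apply, map_smul,
      _root_.smul_apply, hunit, Finset.sum_mul, smul_eq_mul, mul_one, ← hc]
    refine Finset.sum_congr rfl fun i _ ↦ Finset.sum_congr rfl fun j _ ↦ ?_
    rw [Finset.sum_comm]
    refine Finset.sum_congr rfl fun l _ ↦ Finset.sum_congr rfl fun k _ ↦ ?_
    have : (gram g x)⁻¹ j l = (gram g x)⁻¹ l j := by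
      conv_lhs => rw [← hs, Matrix.transpose_apply]
    rw [this]
    ring
  · have := c.invertibleToMatrix b
    exact (Matrix.isUnit_iff_isUnit_det _).1 (isUnit_of_invertible _)

theorem curvatureNorm_pos (g : Metric E M) {Z : VField E M} {x : M} (hZ : MDiffAt (T% Z) x)
    (hunit : g.inner x (Z x) (Z x) = 1) (hcurv : ∃ v w, curvatureAt g Z x v w ≠ 0) :
    0 < curvatureNorm g Z x := by
  rw [curvatureNorm_eq_sqrt g hZ hunit (tangentBasis E x)]
  refine Real.sqrt_pos.2 (mul_pos one_half_pos (formNormSq_pos (posDef_metricForm_toMatrix g _) ?_))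
  intro h
  obtain ⟨v, w, hvw⟩ := hcurv
  apply hvw
  rw [curvatureAt_eq_smul g hZ hunit,
    (LinearMap.BilinForm.toMatrix (tangentBasis E x)).map_eq_zero_iff.1 h]
  simp

/-- The matrix of the metric in a family of vector fields. -/
def frameGram {n : Type*} (g : Metric E M) (X : n → VField E M) (x : M) : Matrix n n ℝ :=
  Matrix.of fun i j ↦ innerFun g (X i) (X j) x

/-- The matrix of the curvature of `D`, measured along `Z`, in a family of vector fields. -/
def frameCurvature {n : Type*} (g : Metric E M) (Z : VField E M) (X : n → VField E M) (x : M) :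
    Matrix n n ℝ :=
  Matrix.of fun i j ↦ innerFun g Z (mlieBracket 𝓘(ℝ, E) (fun y ↦ prD g Z y (X i y))
    (fun y ↦ prD g Z y (X j y))) x

theorem metricForm_toMatrix_frame {n : Type*} [Fintype n] [DecidableEq n] (g : Metric E M)
    {X : n → VField E M} {x : M} {b : Module.Basis n ℝ (TangentSpace 𝓘(ℝ, E) x)}
    (hb : ∀ i, b i = X i x) : (metricForm g x).toMatrix b = frameGram g X x := by
  ext i j
  simp [frameGram, hb, LinearMap.BilinForm.toMatrix_apply, innerFun]

theorem curvatureForm_toMatrix_frame {n : Type*} [Fintype n] [DecidableEq n] (g : Metric E M)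
    {Z : VField E M} {X : n → VField E M} {x : M} (hZ : MDiffAt (T% Z) x)
    (hunit : g.inner x (Z x) (Z x) = 1) (hX : ∀ i, MDiffAt (T% (X i)) x)
    {b : Module.Basis n ℝ (TangentSpace 𝓘(ℝ, E) x)} (hb : ∀ i, b i = X i x) :
    (curvatureForm g hZ (ne_zero_of_unit g hunit)).toMatrix b = frameCurvature g Z X x := by
  ext i j
  simp [frameCurvature, hb, LinearMap.BilinForm.toMatrix_apply, innerFun,
    curvatureForm_field g hZ hunit (hX i) (hX j)]

theorem curvatureNorm_eq_sqrt_frame (g : Metric E M) {Z : VField E M}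
    {X : Fin (Module.finrank ℝ E) → VField E M} {x : M} (hZ : MDiffAt (T% Z) x)
    (hunit : g.inner x (Z x) (Z x) = 1) (hX : ∀ i, MDiffAt (T% (X i)) x)
    (hb : ∃ b : Module.Basis (Fin (Module.finrank ℝ E)) ℝ (TangentSpace 𝓘(ℝ, E) x),
      ∀ i, b i = X i x) :
    curvatureNorm g Z x =
      Real.sqrt ((1 / 2) * formNormSq (frameGram g X x) (frameCurvature g Z X x)) := by
  obtain ⟨b, hb⟩ := hb
  rw [curvatureNorm_eq_sqrt g hZ hunit b, metricForm_toMatrix_frame g hb,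
    curvatureForm_toMatrix_frame g hZ hunit hX hb]

theorem isUnit_det_frameGram {n : Type*} [Fintype n] [DecidableEq n] (g : Metric E M)
    {X : n → VField E M} {x : M}
    (hb : ∃ b : Module.Basis n ℝ (TangentSpace 𝓘(ℝ, E) x), ∀ i, b i = X i x) :
    IsUnit (frameGram g X x).det := by
  obtain ⟨b, hb⟩ := hb
  rw [← metricForm_toMatrix_frame g hb]
  exact (posDef_metricForm_toMatrix g b).det_pos.ne'.isUnit

theorem contMDiff_frameGram {n : Type*} (g : Metric E M) {X : n → VField E M}
    (hX : ∀ i, IsSmoothField (X i)) (i j : n) :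
    ContMDiff 𝓘(ℝ, E) 𝓘(ℝ) ∞ (fun x ↦ frameGram g X x i j) :=
  contMDiff_innerFun g (hX i) (hX j)

theorem contMDiff_frameCurvature {n : Type*} (g : Metric E M) {Z : VField E M}
    (hZ : IsSmoothField Z) (hunit : ∀ x, g.inner x (Z x) (Z x) = 1) {X : n → VField E M}
    (hX : ∀ i, IsSmoothField (X i)) (i j : n) :
    ContMDiff 𝓘(ℝ, E) 𝓘(ℝ) ∞ (fun x ↦ frameCurvature g Z X x i j) :=
  contMDiff_innerFun g hZ ((hZ.prD g hunit (hX i)).mlieBracket (hZ.prD g hunit (hX j)))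

theorem contMDiffAt_formNormSq {n : Type*} [Fintype n] [DecidableEq n] {G Ω : M → Matrix n n ℝ}
    {x : M} (hG : ∀ i j, ContMDiffAt 𝓘(ℝ, E) 𝓘(ℝ) ∞ (fun y ↦ G y i j) x)
    (hΩ : ∀ i j, ContMDiffAt 𝓘(ℝ, E) 𝓘(ℝ) ∞ (fun y ↦ Ω y i j) x) (h0 : IsUnit (G x).det) :
    ContMDiffAt 𝓘(ℝ, E) 𝓘(ℝ) ∞ (fun y ↦ formNormSq (G y) (Ω y)) x := by
  have hH := contMDiffAt_matrix_inv hG h0.ne_zero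
  simp only [formNormSq, Matrix.trace, Matrix.diag, Matrix.mul_apply, Matrix.transpose_apply]
  exact .sum fun i _ ↦ .sum fun j _ ↦ .mul (.sum fun k _ ↦ .mul (.sum fun l _ ↦
    .mul (hH _ _) (hΩ _ _)) (hH _ _)) (hΩ _ _)

/-- Near each point the norm is the square root of a smooth function of frame matrices. Nonvanishing
of `ℛ` keeps the arguments of both the root and the logarithm positive. -/
theorem contMDiff_log_curvatureNorm [T2Space M] (g : Metric E M) {Z : VField E M}
    (hZ : IsSmoothField Z) (hunit : ∀ x, g.inner x (Z x) (Z x) = 1)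
    (hcurv : ∀ x, ∃ v w, curvatureAt g Z x v w ≠ 0) :
    ContMDiff 𝓘(ℝ, E) 𝓘(ℝ) ∞ (fun x ↦ Real.log (curvatureNorm g Z x)) := by
  intro x₀
  obtain ⟨X, hX, hb⟩ := exists_smooth_frame (E := E) x₀
  have hpos := curvatureNorm_pos g (hZ.mdiffAt x₀) (hunit x₀) (hcurv x₀)
  have heq : (fun x ↦ Real.log (curvatureNorm g Z x)) =ᶠ[nhds x₀] fun x ↦
      Real.log (Real.sqrt ((1 / 2) * formNormSq (frameGram g X x) (frameCurvature g Z X x))) := by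
    filter_upwards [hb] with x hx
    rw [curvatureNorm_eq_sqrt_frame g (hZ.mdiffAt x) (hunit x) (fun i ↦ (hX i).mdiffAt x) hx]
  rw [curvatureNorm_eq_sqrt_frame g (hZ.mdiffAt x₀) (hunit x₀) (fun i ↦ (hX i).mdiffAt x₀)
    hb.self_of_nhds] at hpos
  refine ContMDiffAt.congr_of_eventuallyEq ?_ heq
  have h1 := contMDiffAt_formNormSq (fun i j ↦ contMDiff_frameGram g hX i j x₀)
    (fun i j ↦ contMDiff_frameCurvature g hZ hunit hX i j x₀)
    (isUnit_det_frameGram g hb.self_of_nhds)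
  have h2 : ContMDiffAt 𝓘(ℝ) 𝓘(ℝ) ∞ (fun t : ℝ ↦ Real.log (Real.sqrt ((1 / 2) * t)))
      (formNormSq (frameGram g X x₀) (frameCurvature g Z X x₀)) := by
    refine ContDiffAt.contMDiffAt ?_
    exact ((contDiffAt_const.mul contDiffAt_id).sqrt (Real.sqrt_pos.1 hpos).ne').log hpos.ne'
  exact h2.comp x₀ h1

end CurvatureNorm

/-! ### Derivatives of matrix-valued functions along a vector field. -/

section Derivative

variable {E : Type*} [NormedAddCommGroup E] [NormedSpace ℝ E]
  {M : Type*} [TopologicalSpace M] [ChartedSpace E M]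

theorem mvfderiv_comp_real {φ : ℝ → ℝ} {φ' : ℝ} {F : M → ℝ} {x : M} (hφ : HasDerivAt φ φ' (F x))
    (hF : MDiffAt F x) (v : TangentSpace 𝓘(ℝ, E) x) :
    mvfderiv 𝓘(ℝ, E) (fun y ↦ φ (F y)) x v = φ' * mvfderiv 𝓘(ℝ, E) F x v := by
  have h := (hφ.hasFDerivAt.hasMFDerivAt.comp x hF.hasMFDerivAt).mfderiv
  change (mfderiv 𝓘(ℝ, E) 𝓘(ℝ, ℝ) (φ ∘ F) x) v = φ' * (show ℝ from mfderiv 𝓘(ℝ, E) 𝓘(ℝ, ℝ) F x v)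
  rw [h]
  exact mul_comm (show ℝ from mfderiv 𝓘(ℝ, E) 𝓘(ℝ, ℝ) F x v) φ'

theorem derivAlong_congr {Y : VField E M} {f f' : M → ℝ} {x : M} (h : f =ᶠ[nhds x] f') :
    derivAlong Y f x = derivAlong Y f' x := by
  simp only [derivAlong, mvfderiv]
  rw [h.mfderiv_eq]
  rfl

theorem derivAlong_const (Y : VField E M) (c : ℝ) (x : M) : derivAlong Y (fun _ ↦ c) x = 0 := by
  simp [derivAlong, mvfderiv_const]

theorem derivAlong_add {Y : VField E M} {f f' : M → ℝ} {x : M} (hf : MDiffAt f x)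
    (hf' : MDiffAt f' x) :
    derivAlong Y (fun y ↦ f y + f' y) x = derivAlong Y f x + derivAlong Y f' x := by
  have := mvfderiv_add hf hf'
  simp only [derivAlong]
  exact congr($this (Y x))

theorem derivAlong_mul {Y : VField E M} {f f' : M → ℝ} {x : M} (hf : MDiffAt f x)
    (hf' : MDiffAt f' x) :
    derivAlong Y (fun y ↦ f y * f' y) x = derivAlong Y f x * f' x + f x * derivAlong Y f' x := by
  have := mvfderiv_mul hf hf'
  simp only [derivAlong]
  refine (congr($this (Y x))).trans ?_
  simp
  ring

theorem derivAlong_sum {ι : Type*} {Y : VField E M} {s : Finset ι} {f : ι → M → ℝ} {x : M}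
    (hf : ∀ i ∈ s, MDiffAt (f i) x) :
    MDiffAt (fun y ↦ ∑ i ∈ s, f i y) x ∧
      derivAlong Y (fun y ↦ ∑ i ∈ s, f i y) x = ∑ i ∈ s, derivAlong Y (f i) x := by
  classical
  induction s using Finset.induction_on with
  | empty => simpa using ⟨mdifferentiableAt_const, derivAlong_const Y 0 x⟩
  | insert a s ha ih =>
    obtain ⟨h1, h2⟩ := ih fun i hi ↦ hf i (Finset.mem_insert_of_mem hi)
    have h3 := hf a (Finset.mem_insert_self a s)
    simp only [Finset.sum_insert ha]
    exact ⟨h3.add h1, by rw [derivAlong_add h3 h1, h2]⟩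

variable {n : Type*} [Fintype n]

/-- The entrywise derivative of a matrix-valued function along a vector field. -/
def matrixDeriv (Y : VField E M) (A : M → Matrix n n ℝ) (x : M) : Matrix n n ℝ :=
  Matrix.of fun i j ↦ derivAlong Y (fun y ↦ A y i j) x

theorem mdiffAt_matrix_mul {A B : M → Matrix n n ℝ} {x : M}
    (hA : ∀ i j, MDiffAt (fun y ↦ A y i j) x) (hB : ∀ i j, MDiffAt (fun y ↦ B y i j) x)
    (i j : n) : MDiffAt (fun y ↦ (A y * B y) i j) x := by
  simp only [Matrix.mul_apply]
  exact (derivAlong_sum (Y := 0) fun k _ ↦ (hA i k).mul (hB k j)).1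

theorem matrixDeriv_mul {Y : VField E M} {A B : M → Matrix n n ℝ} {x : M}
    (hA : ∀ i j, MDiffAt (fun y ↦ A y i j) x) (hB : ∀ i j, MDiffAt (fun y ↦ B y i j) x) :
    matrixDeriv Y (fun y ↦ A y * B y) x = matrixDeriv Y A x * B x + A x * matrixDeriv Y B x := by
  ext i j
  simp only [matrixDeriv, Matrix.of_apply, Matrix.add_apply, Matrix.mul_apply]
  rw [← Finset.sum_add_distrib]
  refine (derivAlong_sum fun k _ ↦ (hA i k).mul (hB k j)).2.trans ?_
  exact Finset.sum_congr rfl fun k _ ↦ derivAlong_mul (hA i k) (hB k j)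

theorem derivAlong_trace {Y : VField E M} {A : M → Matrix n n ℝ} {x : M}
    (hA : ∀ i j, MDiffAt (fun y ↦ A y i j) x) :
    derivAlong Y (fun y ↦ (A y).trace) x = (matrixDeriv Y A x).trace :=
  (derivAlong_sum fun i _ ↦ hA i i).2

theorem derivAlong_formNormSq [DecidableEq n] {Y : VField E M} {G Ω : M → Matrix n n ℝ} {x : M}
    (hΩ : ∀ i j, MDiffAt (fun y ↦ Ω y i j) x)
    (hH : ∀ i j, MDiffAt (fun y ↦ (G y)⁻¹ i j) x) :
    derivAlong Y (fun y ↦ formNormSq (G y) (Ω y)) x =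
      (matrixDeriv Y (fun y ↦ (G y)⁻¹) x * Ω x * (G x)⁻¹ * (Ω x).transpose
        + (G x)⁻¹ * matrixDeriv Y Ω x * (G x)⁻¹ * (Ω x).transpose
        + (G x)⁻¹ * Ω x * matrixDeriv Y (fun y ↦ (G y)⁻¹) x * (Ω x).transpose
        + (G x)⁻¹ * Ω x * (G x)⁻¹ * (matrixDeriv Y Ω x).transpose).trace := by
  have hΩt : ∀ i j, MDiffAt (fun y ↦ (Ω y).transpose i j) x := fun i j ↦ hΩ j i
  have h1 := mdiffAt_matrix_mul hH hΩ
  have h2 := mdiffAt_matrix_mul h1 hH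
  have h3 := mdiffAt_matrix_mul h2 hΩt
  simp only [formNormSq]
  rw [derivAlong_trace h3, matrixDeriv_mul h2 hΩt, matrixDeriv_mul h1 hH, matrixDeriv_mul hH hΩ]
  simp only [Matrix.add_mul]
  rfl

/-- Obtained by differentiating `G⁻¹ G = 1`, which holds in a neighbourhood of `x`. -/
theorem matrixDeriv_inv [DecidableEq n] {Y : VField E M} {G : M → Matrix n n ℝ} {x : M}
    (hG : ∀ i j, MDiffAt (fun y ↦ G y i j) x) (hH : ∀ i j, MDiffAt (fun y ↦ (G y)⁻¹ i j) x)
    (hdet : ∀ᶠ y in nhds x, IsUnit (G y).det) :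
    matrixDeriv Y (fun y ↦ (G y)⁻¹) x * G x + (G x)⁻¹ * matrixDeriv Y G x = 0 := by
  rw [← matrixDeriv_mul hH hG]
  ext i j
  rw [matrixDeriv, Matrix.of_apply, Matrix.zero_apply,
    ← derivAlong_const Y ((1 : Matrix n n ℝ) i j) x]
  refine derivAlong_congr ?_
  filter_upwards [hdet] with y hy
  rw [Matrix.nonsing_inv_mul _ hy]

end Derivative

/-! ### Invariance of the rescaled curvature under the field `ψ Z`. -/

section Invariance

variable {E : Type*} [NormedAddCommGroup E] [NormedSpace ℝ E] [FiniteDimensional ℝ E]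
  {M : Type*} [TopologicalSpace M] [ChartedSpace E M] [IsManifold 𝓘(ℝ, E) ∞ M]

theorem inner_prD_of_unit (g : Metric E M) {Z : VField E M} {x : M}
    (hunit : g.inner x (Z x) (Z x) = 1) (v : TangentSpace 𝓘(ℝ, E) x) :
    g.inner x (Z x) (prD g Z x v) = 0 := by
  simp [prD_apply_of_unit g hunit, hunit]

theorem inner_eq_transverseMetric_add (g : Metric E M) {Z : VField E M} {x : M}
    (hunit : g.inner x (Z x) (Z x) = 1) (v w : TangentSpace 𝓘(ℝ, E) x) :
    g.inner x v w = transverseMetric g Z x v w + g.inner x (Z x) v * g.inner x (Z x) w := by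
  simp [transverseMetric, prD_apply_of_unit g hunit, hunit, g.symm x v (Z x)]
  ring

/-- `ψ Z` is the rescaling of `Z` whose flow preserves `D`. -/
structure IsScaling (g : Metric E M) (Z : VField E M) (ψ : M → ℝ) : Prop where
  smooth : ContMDiff 𝓘(ℝ, E) 𝓘(ℝ) ∞ ψ
  pos : ∀ x, 0 < ψ x
  inner_mlieBracket : ∀ W : VField E M, IsSmoothField W → (∀ x, g.inner x (Z x) (W x) = 0) →
    ∀ x, ψ x * g.inner x (Z x) (mlieBracket 𝓘(ℝ, E) Z W x) = mvfderiv 𝓘(ℝ, E) ψ x (W x)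

variable {g : Metric E M} {Z : VField E M} {ψ : M → ℝ}

theorem IsScaling.mdiffAt (h : IsScaling g Z ψ) (x : M) : MDiffAt ψ x :=
  (h.smooth x).mdifferentiableAt (by simp)

theorem IsScaling.contMDiff_inv (h : IsScaling g Z ψ) :
    ContMDiff 𝓘(ℝ, E) 𝓘(ℝ) ∞ (fun x ↦ (ψ x)⁻¹) :=
  fun x ↦ (h.smooth x).inv₀ (h.pos x).ne'

/-- The last field of `IsScaling` is this statement in disguise, because `[ψZ, W] = ψ [Z, W] - (Wψ)
Z`. -/
theorem IsScaling.inner_mlieBracket_horizontal (h : IsScaling g Z ψ) (hZ : IsSmoothField Z)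
    (hunit : ∀ x, g.inner x (Z x) (Z x) = 1) {W : VField E M} (hW : IsSmoothField W)
    (hWZ : ∀ x, g.inner x (Z x) (W x) = 0) (x : M) :
    g.inner x (Z x) (mlieBracket 𝓘(ℝ, E) (ψ • Z) W x) = 0 := by
  rw [mlieBracket_smul_left (h.mdiffAt x) (hZ.mdiffAt x)]
  simp [hunit, h.inner_mlieBracket W hW hWZ x]

/-- Decompose `X = pr_D X + θ(X) ψZ` with `θ = ψ⁻¹ g(Z, ·)` and use `[ψZ, ψZ] = 0`. The two summands
are horizontal and vertical respectively, so invariance of `pr_D` and of `θ` can be read off. -/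
theorem IsScaling.mlieBracket_eq_add (h : IsScaling g Z ψ) (hZ : IsSmoothField Z)
    (hunit : ∀ x, g.inner x (Z x) (Z x) = 1) {X : VField E M} (hX : IsSmoothField X) (x : M) :
    mlieBracket 𝓘(ℝ, E) (ψ • Z) X x =
      mlieBracket 𝓘(ℝ, E) (ψ • Z) (fun y ↦ prD g Z y (X y)) x +
        derivAlong (ψ • Z) (fun y ↦ (ψ y)⁻¹ * innerFun g Z X y) x • (ψ • Z) x := by
  have hY : IsSmoothField (ψ • Z) := hZ.smul h.smooth
  have hf : ContMDiff 𝓘(ℝ, E) 𝓘(ℝ) ∞ (fun y ↦ (ψ y)⁻¹ * innerFun g Z X y) :=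
    h.contMDiff_inv.mul (contMDiff_innerFun g hZ hX)
  have e : X = (fun y ↦ prD g Z y (X y)) + (fun y ↦ (ψ y)⁻¹ * innerFun g Z X y) • (ψ • Z) := by
    ext y
    have h0 : (ψ y)⁻¹ * g.inner y (Z y) (X y) * ψ y = g.inner y (Z y) (X y) := by
      field_simp [(h.pos y).ne']
    simp only [Pi.add_apply, Pi.smul_apply', Pi.mul_apply, smul_smul,
      prD_apply_of_unit g (hunit y), innerFun, h0]
    abel
  conv_lhs => rw [e]
  rw [mlieBracket_add_right ((hZ.prD g hunit hX).mdiffAt x) ((hY.smul hf).mdiffAt x),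
    mlieBracket_smul_right ((hf x).mdifferentiableAt (by simp)) (hY.mdiffAt x)]
  simp [derivAlong]

theorem IsScaling.prD_mlieBracket (h : IsScaling g Z ψ) (hZ : IsSmoothField Z)
    (hunit : ∀ x, g.inner x (Z x) (Z x) = 1) {X : VField E M} (hX : IsSmoothField X) (x : M) :
    prD g Z x (mlieBracket 𝓘(ℝ, E) (ψ • Z) X x) =
      mlieBracket 𝓘(ℝ, E) (ψ • Z) (fun y ↦ prD g Z y (X y)) x := by
  have h1 := h.inner_mlieBracket_horizontal hZ hunit (hZ.prD g hunit hX)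
    (fun y ↦ inner_prD_of_unit g (hunit y) (X y)) x
  rw [h.mlieBracket_eq_add hZ hunit hX x, prD_apply_of_unit g (hunit x)]
  simp [h1, hunit, smul_smul]

/-- Invariance of the one-form `θ = ψ⁻¹ g(Z, ·)` under `ψZ`. -/
theorem IsScaling.derivAlong_innerFun (h : IsScaling g Z ψ) (hZ : IsSmoothField Z)
    (hunit : ∀ x, g.inner x (Z x) (Z x) = 1) {X : VField E M} (hX : IsSmoothField X) (x : M) :
    derivAlong (ψ • Z) (fun y ↦ (ψ y)⁻¹ * innerFun g Z X y) x =
      (ψ x)⁻¹ * g.inner x (Z x) (mlieBracket 𝓘(ℝ, E) (ψ • Z) X x) := by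
  have h1 := h.inner_mlieBracket_horizontal hZ hunit (hZ.prD g hunit hX)
    (fun y ↦ inner_prD_of_unit g (hunit y) (X y)) x
  have := (h.pos x).ne'
  rw [h.mlieBracket_eq_add hZ hunit hX x]
  simp [h1, hunit]
  field_simp

/-- The curvature two-form of `D`, rescaled by `ψ⁻¹`, is invariant under `ψ Z`. -/
theorem IsScaling.derivAlong_curvature (h : IsScaling g Z ψ) (hZ : IsSmoothField Z)
    (hunit : ∀ x, g.inner x (Z x) (Z x) = 1) {X X' : VField E M} (hX : IsSmoothField X)
    (hX' : IsSmoothField X') (x : M) :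
    derivAlong (ψ • Z) (fun y ↦ (ψ y)⁻¹ * innerFun g Z (mlieBracket 𝓘(ℝ, E)
        (fun y ↦ prD g Z y (X y)) (fun y ↦ prD g Z y (X' y))) y) x =
      (ψ x)⁻¹ * (curvatureForm g (hZ.mdiffAt x) (ne_zero_of_unit g (hunit x))
          (mlieBracket 𝓘(ℝ, E) (ψ • Z) X x) (X' x) +
        curvatureForm g (hZ.mdiffAt x) (ne_zero_of_unit g (hunit x))
          (X x) (mlieBracket 𝓘(ℝ, E) (ψ • Z) X' x)) := by
  have hY : IsSmoothField (ψ • Z) := hZ.smul h.smooth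
  have hp := hZ.prD g hunit hX
  have hp' := hZ.prD g hunit hX'
  -- Invariance of `θ` moves the derivative onto the bracket, and the Jacobi identity distributes it
  -- over the two horizontal arguments.
  rw [h.derivAlong_innerFun hZ hunit (hp.mlieBracket hp'), mlieBracket_leibniz hY hp hp',
    curvatureForm_field g (hZ.mdiffAt x) (hunit x) ((hY.mlieBracket hX).mdiffAt x)
      (hX'.mdiffAt x),
    curvatureForm_field g (hZ.mdiffAt x) (hunit x) (hX.mdiffAt x)
      ((hY.mlieBracket hX').mdiffAt x)]
  have e1 : (fun y ↦ prD g Z y (mlieBracket 𝓘(ℝ, E) (ψ • Z) X y)) =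
      mlieBracket 𝓘(ℝ, E) (ψ • Z) (fun y ↦ prD g Z y (X y)) :=
    funext fun y ↦ h.prD_mlieBracket hZ hunit hX y
  have e2 : (fun y ↦ prD g Z y (mlieBracket 𝓘(ℝ, E) (ψ • Z) X' y)) =
      mlieBracket 𝓘(ℝ, E) (ψ • Z) (fun y ↦ prD g Z y (X' y)) :=
    funext fun y ↦ h.prD_mlieBracket hZ hunit hX' y
  rw [e1, e2, map_add]

/-- The Lie derivative of the metric along `ψ Z` is a multiple of the square of the covector dual
to `Z`. -/
theorem IsScaling.derivAlong_metric (h : IsScaling g Z ψ) (hZ : IsSmoothField Z)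
    (hunit : ∀ x, g.inner x (Z x) (Z x) = 1) (hRiem : IsRiemannianFoliation g Z)
    {X X' : VField E M} (hX : IsSmoothField X) (hX' : IsSmoothField X') (x : M) :
    derivAlong (ψ • Z) (innerFun g X X') x =
      2 * (ψ x)⁻¹ * derivAlong (ψ • Z) ψ x * (g.inner x (Z x) (X x) * g.inner x (Z x) (X' x))
        + g.inner x (mlieBracket 𝓘(ℝ, E) (ψ • Z) X x) (X' x)
        + g.inner x (X x) (mlieBracket 𝓘(ℝ, E) (ψ • Z) X' x) := by
  have hY : IsSmoothField (ψ • Z) := hZ.smul h.smooth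
  have hL := hRiem (ψ • Z) hY (fun y ↦ Submodule.smul_mem _ _ (Submodule.mem_span_singleton_self _))
    X X' hX hX' x
  -- Since `η = ψ θ` with `θ` invariant, the Lie derivative of `η` is `ψ⁻¹ (Yψ) η` for `Y = ψZ`. The
  -- factor `2` in the conclusion comes from applying this to both factors of `η ⊗ η`.
  have hη (W : VField E M) (hW : IsSmoothField W) :
      derivAlong (ψ • Z) (innerFun g Z W) x =
        (ψ x)⁻¹ * derivAlong (ψ • Z) ψ x * g.inner x (Z x) (W x)
          + g.inner x (Z x) (mlieBracket 𝓘(ℝ, E) (ψ • Z) W x) := by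
    have h0 := (h.pos x).ne'
    have e : innerFun g Z W = fun y ↦ ψ y * ((ψ y)⁻¹ * innerFun g Z W y) := by
      ext y; rw [mul_inv_cancel_left₀ (h.pos y).ne']
    have hd : MDiffAt (fun y ↦ (ψ y)⁻¹ * innerFun g Z W y) x :=
      ((h.contMDiff_inv.mul (contMDiff_innerFun g hZ hW)) x).mdifferentiableAt (by simp)
    rw [e, derivAlong_mul (h.mdiffAt x) hd, h.derivAlong_innerFun hZ hunit hW]
    simp only [innerFun]
    field_simp
  have hm : MDiffAt (innerFun g Z X) x := mdifferentiableAt_innerFun g (hZ.mdiffAt x) (hX.mdiffAt x)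
  have hm' : MDiffAt (innerFun g Z X') x :=
    mdifferentiableAt_innerFun g (hZ.mdiffAt x) (hX'.mdiffAt x)
  have hp := hZ.prD g hunit hX
  have hp' := hZ.prD g hunit hX'
  have ht : MDiffAt (fun y ↦ transverseMetric g Z y (X y) (X' y)) x :=
    mdifferentiableAt_innerFun g (hp.mdiffAt x) (hp'.mdiffAt x)
  have e : innerFun g X X' = fun y ↦ transverseMetric g Z y (X y) (X' y) +
      innerFun g Z X y * innerFun g Z X' y :=
    funext fun y ↦ inner_eq_transverseMetric_add g (hunit y) _ _
  have hmm : MDiffAt (fun y ↦ innerFun g Z X y * innerFun g Z X' y) x := hm.mul hm'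
  rw [e, derivAlong_add ht hmm, derivAlong_mul hm hm', hη X hX, hη X' hX',
    inner_eq_transverseMetric_add g (hunit x) (mlieBracket 𝓘(ℝ, E) (ψ • Z) X x),
    inner_eq_transverseMetric_add g (hunit x) (X x)]
  simp only [lieDerivative] at hL
  simp only [innerFun]
  linear_combination hL

theorem curvatureForm_self_left (hZ : IsSmoothField Z) (hunit : ∀ x, g.inner x (Z x) (Z x) = 1)
    {X : VField E M} (hX : IsSmoothField X) (x : M) :
    curvatureForm g (hZ.mdiffAt x) (ne_zero_of_unit g (hunit x)) (Z x) (X x) = 0 := by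
  rw [curvatureForm_field g (hZ.mdiffAt x) (hunit x) (hZ.mdiffAt x) (hX.mdiffAt x)]
  have e : (fun y ↦ prD g Z y (Z y)) = 0 := by
    ext y; simp [prD_apply_of_unit g (hunit y), hunit]
  simp [e]

theorem frameCurvature_transpose {n : Type*} (g : Metric E M) (Z : VField E M)
    (X : n → VField E M) (x : M) :
    (frameCurvature g Z X x).transpose = - frameCurvature g Z X x := by
  ext i j
  simp only [frameCurvature, innerFun, Matrix.transpose_apply, Matrix.neg_apply, Matrix.of_apply]
  rw [mlieBracket_swap_apply, map_neg]

/-- Multiplying by the inverse Gram matrix turns the covector `η` back into the coordinates of `Z`,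
and `Z` lies in the kernel of the curvature form. -/
theorem vecMul_gram_inv_curvature {n : Type*} [Fintype n] [DecidableEq n] (hZ : IsSmoothField Z)
    (hunit : ∀ x, g.inner x (Z x) (Z x) = 1) {X : n → VField E M} (hX : ∀ i, IsSmoothField (X i))
    {x : M} {b : Module.Basis n ℝ (TangentSpace 𝓘(ℝ, E) x)} (hb : ∀ i, b i = X i x) :
    Matrix.vecMul (fun i ↦ g.inner x (Z x) (X i x))
      ((frameGram g X x)⁻¹ * frameCurvature g Z X x) = 0 := by
  have hη : (fun i ↦ g.inner x (Z x) (X i x)) = Matrix.vecMul (b.repr (Z x)) (frameGram g X x) := by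
    ext i
    conv_lhs => rw [← b.sum_repr (Z x)]
    simp [Matrix.vecMul, dotProduct, frameGram, innerFun, hb]
  rw [hη, Matrix.vecMul_vecMul, Matrix.mul_nonsing_inv_cancel_left _ _
    (isUnit_det_frameGram g ⟨b, hb⟩)]
  ext j
  rw [← curvatureForm_toMatrix_frame g (hZ.mdiffAt x) (hunit x) (fun i ↦ (hX i).mdiffAt x) hb]
  have := curvatureForm_self_left (g := g) hZ hunit (hX j) x
  rw [← b.sum_repr (Z x)] at this
  simpa [Matrix.vecMul, dotProduct, LinearMap.BilinForm.toMatrix_apply, hb] using this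

/-- The rescaled curvature norm is invariant under `ψ Z`. -/
theorem IsScaling.derivAlong_formNormSq {n : Type*} [Fintype n] [DecidableEq n]
    (h : IsScaling g Z ψ) (hZ : IsSmoothField Z)
    (hunit : ∀ x, g.inner x (Z x) (Z x) = 1) (hRiem : IsRiemannianFoliation g Z)
    {X : n → VField E M} (hX : ∀ i, IsSmoothField (X i)) {x : M}
    (hb : ∀ᶠ y in nhds x, ∃ b : Module.Basis n ℝ (TangentSpace 𝓘(ℝ, E) y), ∀ i, b i = X i y) :
    derivAlong (ψ • Z) (fun y ↦ formNormSq (frameGram g X y)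
      ((ψ y)⁻¹ • frameCurvature g Z X y)) x = 0 := by
  obtain ⟨b, hbx⟩ := hb.self_of_nhds
  have hdet := isUnit_det_frameGram g ⟨b, hbx⟩
  have hG : ∀ i j, MDiffAt (fun y ↦ frameGram g X y i j) x := fun i j ↦
    (contMDiff_frameGram g hX i j x).mdifferentiableAt (by simp)
  have hH : ∀ i j, MDiffAt (fun y ↦ (frameGram g X y)⁻¹ i j) x := fun i j ↦
    (contMDiffAt_matrix_inv (fun i j ↦ contMDiff_frameGram g hX i j x) hdet.ne_zero
      i j).mdifferentiableAt (by simp)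
  have hΩ : ∀ i j, MDiffAt (fun y ↦ ((ψ y)⁻¹ • frameCurvature g Z X y) i j) x := fun i j ↦
    ((h.contMDiff_inv.mul (contMDiff_frameCurvature g hZ hunit hX i j)) x).mdifferentiableAt
      (by simp)
  have hη := vecMul_gram_inv_curvature (g := g) hZ hunit hX hbx
  rw [LineFoliation.derivAlong_formNormSq hΩ hH]
  -- The frame need not be invariant under `ψZ`; `C` records its infinitesimal change, which the
  -- norm ignores.
  let C : Matrix n n ℝ := Matrix.of fun i k ↦ b.repr (mlieBracket 𝓘(ℝ, E) (ψ • Z) (X i) x) k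
  have hC (i : n) : mlieBracket 𝓘(ℝ, E) (ψ • Z) (X i) x = ∑ k, C i k • X k x := by
    simp only [C, Matrix.of_apply, ← hbx, b.sum_repr]
  refine trace_derivative_eq_zero (C := C) (η := fun i ↦ g.inner x (Z x) (X i x))
    (c := 2 * (ψ x)⁻¹ * derivAlong (ψ • Z) ψ x) hdet
    (matrixDeriv_inv hG hH (hb.mono fun y hy ↦ isUnit_det_frameGram g hy)) ?_ ?_ ?_ ?_
  · ext i j
    refine (h.derivAlong_metric hZ hunit hRiem (hX i) (hX j) x).trans ?_
    rw [hC i, hC j]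
    simp [Matrix.mul_apply, frameGram, innerFun, Matrix.vecMulVec_apply, mul_comm]
  · ext i j
    refine (h.derivAlong_curvature hZ hunit (hX i) (hX j) x).trans ?_
    rw [hC i, hC j, ← curvatureForm_toMatrix_frame g (hZ.mdiffAt x) (hunit x)
      (fun i ↦ (hX i).mdiffAt x) hbx]
    simp [Matrix.mul_apply, hbx, mul_add, Finset.mul_sum, LinearMap.BilinForm.toMatrix_apply,
      mul_comm]
  · rw [Matrix.mul_smul, Matrix.vecMul_smul, hη, smul_zero]
  · rw [Matrix.transpose_smul, frameCurvature_transpose, Matrix.mul_smul, Matrix.mul_neg,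
      Matrix.vecMul_smul, Matrix.vecMul_neg, hη, neg_zero, smul_zero]

theorem IsScaling.mvfderiv_log_curvatureNorm [T2Space M] (h : IsScaling g Z ψ)
    (hZ : IsSmoothField Z) (hunit : ∀ x, g.inner x (Z x) (Z x) = 1)
    (hRiem : IsRiemannianFoliation g Z) (hcurv : ∀ x, ∃ v w, curvatureAt g Z x v w ≠ 0) (x : M) :
    mvfderiv 𝓘(ℝ, E) (fun y ↦ Real.log (curvatureNorm g Z y) - Real.log (ψ y)) x (Z x) = 0 := by
  obtain ⟨X, hX, hb⟩ := exists_smooth_frame (E := E) x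
  set F : M → ℝ := fun y ↦ formNormSq (frameGram g X y) ((ψ y)⁻¹ • frameCurvature g Z X y) with hF
  -- Scaling the form by `ψ⁻¹` scales its norm by `ψ⁻¹`, which accounts for the term `- log ψ`.
  have hnorm (y : M) (hy : ∃ b : Module.Basis (Fin (Module.finrank ℝ E)) ℝ
      (TangentSpace 𝓘(ℝ, E) y), ∀ i, b i = X i y) :
      Real.sqrt ((1 / 2) * F y) = (ψ y)⁻¹ * curvatureNorm g Z y := by
    rw [curvatureNorm_eq_sqrt_frame g (hZ.mdiffAt y) (hunit y) (fun i ↦ (hX i).mdiffAt y) hy, hF]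
    simp only [formNormSq_smul]
    rw [mul_left_comm, Real.sqrt_mul (sq_nonneg _), Real.sqrt_sq (inv_nonneg.2 (h.pos y).le)]
  have heq : (fun y ↦ Real.log (curvatureNorm g Z y) - Real.log (ψ y)) =ᶠ[nhds x]
      fun y ↦ Real.log (Real.sqrt ((1 / 2) * F y)) := by
    filter_upwards [hb] with y hy
    rw [hnorm y hy, Real.log_mul (inv_ne_zero (h.pos y).ne')
      (curvatureNorm_pos g (hZ.mdiffAt y) (hunit y) (hcurv y)).ne', Real.log_inv]
    ring
  have hpos : 0 < Real.sqrt ((1 / 2) * F x) := by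
    rw [hnorm x hb.self_of_nhds]
    exact mul_pos (inv_pos.2 (h.pos x)) (curvatureNorm_pos g (hZ.mdiffAt x) (hunit x) (hcurv x))
  have hφ : DifferentiableAt ℝ (fun t : ℝ ↦ Real.log (Real.sqrt ((1 / 2) * t))) (F x) := by
    generalize F x = a at hpos
    exact (((differentiableAt_const _).mul differentiableAt_id).sqrt
      (Real.sqrt_pos.1 hpos).ne').log hpos.ne'
  have hFd : MDiffAt F x := (contMDiffAt_formNormSq (fun i j ↦ contMDiff_frameGram g hX i j x)
    (fun i j ↦ (h.contMDiff_inv.mul (contMDiff_frameCurvature g hZ hunit hX i j)) x)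
    (isUnit_det_frameGram g hb.self_of_nhds)).mdifferentiableAt (by simp)
  have h0 := h.derivAlong_formNormSq hZ hunit hRiem hX hb
  have h1 : derivAlong Z F x = 0 := by
    have h2 : ψ x * derivAlong Z F x = 0 := by
      simpa [derivAlong] using h0
    exact (mul_eq_zero.1 h2).resolve_left (h.pos x).ne'
  have h3 := derivAlong_congr (Y := Z) heq
  simp only [derivAlong] at h1 h3
  rw [h3, mvfderiv_comp_real hφ.hasDerivAt hFd, h1, mul_zero]

end Invariance

/-! ### Totally geodesic leaves in terms of the mean curvature for `g₀`. -/

section TotallyGeodesic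

variable {E : Type*} [NormedAddCommGroup E] [NormedSpace ℝ E] [FiniteDimensional ℝ E]
  {M : Type*} [TopologicalSpace M] [ChartedSpace E M] [IsManifold 𝓘(ℝ, E) ∞ M]

theorem inner_prD_left (g : Metric E M) (Z : VField E M) (x : M)
    (v w : TangentSpace 𝓘(ℝ, E) x) :
    g.inner x (prD g Z x v) w = g.inner x v (prD g Z x w) := by
  simp [prD, prV, g.symm x v (Z x)]
  ring

theorem prD_self (g : Metric E M) {Z : VField E M} {x : M} (hZx : Z x ≠ 0) :
    prD g Z x (Z x) = 0 := by
  have := (g.pos x (Z x) hZx).ne'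
  simp [prD, prV, this]

theorem prD_eq_of_inner_eq {g g₀ : Metric E M} {Z : VField E M} {x : M} {u : ℝ} (hu : u ≠ 0)
    (hg : ∀ v, g.inner x (Z x) v = u * g₀.inner x (Z x) v) : prD g Z x = prD g₀ Z x := by
  ext v
  simp only [prD, prV, _root_.sub_apply, ContinuousLinearMap.smulRight_apply, _root_.smul_apply,
    hg, smul_eq_mul]
  congr 2
  field_simp

/-- In rank one the form is determined by `∇_Z Z`: the derivative term of the Leibniz rule points
along `Z` and is killed by `pr_D`. -/
theorem secondFundamentalForm_eq_smul (g : Metric E M) {Z A B : VField E M}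
    (hZ : IsSmoothField Z) (hZ0 : ∀ x, Z x ≠ 0) (hB : IsSmoothField B) (x : M) :
    secondFundamentalForm g Z A B x =
      (((g.inner x (Z x) (Z x))⁻¹ * g.inner x (Z x) (A x)) *
        ((g.inner x (Z x) (Z x))⁻¹ * g.inner x (Z x) (B x))) •
        prD g Z x (leviCivita g Z x (Z x)) := by
  have hb : MDiffAt (fun y ↦ (innerFun g Z Z y)⁻¹ * innerFun g Z B y) x :=
    ((mdifferentiableAt_innerFun g (hZ.mdiffAt x) (hZ.mdiffAt x)).inv
      (g.pos x (Z x) (hZ0 x)).ne').mul (mdifferentiableAt_innerFun g (hZ.mdiffAt x) (hB.mdiffAt x))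
  have e : (fun y ↦ prV g Z y (B y)) =
      (fun y ↦ (innerFun g Z Z y)⁻¹ * innerFun g Z B y) • Z := by
    ext y; simp [prV, innerFun]
  have hl := (leviCivita g).isCovariantDerivativeOnUniv.leibniz (hZ.mdiffAt x) hb
  simp only [secondFundamentalForm]
  rw [e]
  change prD g Z x ((leviCivita g).toFun _ x _) = _
  rw [hl]
  simp only [_root_.add_apply, _root_.smul_apply, ContinuousLinearMap.smulRight_apply, map_add,
    map_smul, prD_self g (hZ0 x), smul_zero, add_zero]
  simp only [prV, ContinuousLinearMap.smulRight_apply, _root_.smul_apply, map_smul, innerFun,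
    smul_eq_mul, smul_smul]
  rw [mul_comm]

/-- Koszul's formula with `W = pr_D X`: as `g(Z, W) = 0` and `[Z, Z] = 0`, only the derivative of
`g(Z, Z) = u` and the two equal terms in `[Z, W]` survive. -/
theorem inner_prD_leviCivita {g g₀ : Metric E M} {Z : VField E M} {u : M → ℝ}
    (hZ : IsSmoothField Z) (hunit : ∀ x, g₀.inner x (Z x) (Z x) = 1) (hu : ∀ x, u x ≠ 0)
    (hg : ∀ x v, g.inner x (Z x) v = u x * g₀.inner x (Z x) v) {X : VField E M}
    (hX : IsSmoothField X) (x : M) :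
    g.inner x (prD g Z x (leviCivita g Z x (Z x))) (X x) =
      - (1 / 2) * mvfderiv 𝓘(ℝ, E) u x (prD g₀ Z x (X x))
        - u x * g₀.inner x (Z x) (mlieBracket 𝓘(ℝ, E) Z (fun y ↦ prD g₀ Z y (X y)) x) := by
  have hW := hZ.prD g₀ hunit hX
  rw [inner_prD_left, prD_eq_of_inner_eq (hu x) (hg x)]
  refine (inner_leviCivitaAt g (hZ.mdiffAt x) (hZ.mdiffAt x) (hW.mdiffAt x)).trans ?_
  have e1 : innerFun g Z Z = u := by
    ext y; simp [innerFun, hg, hunit]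
  have e2 : innerFun g Z (fun y ↦ prD g₀ Z y (X y)) = fun _ ↦ 0 := by
    ext y; simp [innerFun, hg, inner_prD_of_unit g₀ (hunit y)]
  simp only [koszul, e1, e2, derivAlong_const, mlieBracket_self, Pi.zero_apply, map_zero,
    _root_.zero_apply, g.symm x _ (Z x), hg]
  simp only [derivAlong]
  ring

theorem isTotallyGeodesic_iff [T2Space M] {g g₀ : Metric E M} {Z : VField E M} {u : M → ℝ}
    (hZ : IsSmoothField Z) (hunit : ∀ x, g₀.inner x (Z x) (Z x) = 1) (hu : ∀ x, u x ≠ 0)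
    (hg : ∀ x v, g.inner x (Z x) v = u x * g₀.inner x (Z x) v) :
    IsTotallyGeodesic g Z ↔ ∀ X : VField E M, IsSmoothField X → ∀ x,
      (1 / 2) * mvfderiv 𝓘(ℝ, E) u x (prD g₀ Z x (X x)) =
        - (u x * g₀.inner x (Z x) (mlieBracket 𝓘(ℝ, E) Z (fun y ↦ prD g₀ Z y (X y)) x)) := by
  have hZ0 (x : M) := ne_zero_of_unit g₀ (hunit x)
  constructor
  · intro h X hX x
    have h1 := h Z Z hZ hZ x
    rw [secondFundamentalForm_eq_smul g hZ hZ0 hZ,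
      inv_mul_cancel₀ (g.pos x (Z x) (hZ0 x)).ne', mul_one, one_smul] at h1
    have h2 := inner_prD_leviCivita hZ hunit hu hg hX x
    simp only [h1, map_zero, _root_.zero_apply] at h2
    linarith
  · intro h A B hA hB x
    rw [secondFundamentalForm_eq_smul g hZ hZ0 hB]
    refine smul_eq_zero_of_right _ (ext_inner g x fun w ↦ ?_)
    obtain ⟨X, hX, rfl⟩ := exists_smooth_extension w
    rw [inner_prD_leviCivita hZ hunit hu hg hX x]
    simp only [map_zero, _root_.zero_apply]
    linarith [h X hX x]

theorem inner_meanCurvature {g : Metric E M} {Z : VField E M} (hZ : IsSmoothField Z)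
    (hunit : ∀ x, g.inner x (Z x) (Z x) = 1) {X : VField E M} (hX : IsSmoothField X) (x : M) :
    g.inner x (meanCurvature g Z x) (X x) =
      - g.inner x (Z x) (mlieBracket 𝓘(ℝ, E) Z (fun y ↦ prD g Z y (X y)) x) := by
  rw [meanCurvature, secondFundamentalForm_eq_smul g hZ (fun x ↦ ne_zero_of_unit g (hunit x)) hZ,
    hunit, inv_one, one_mul, one_mul, one_smul,
    inner_prD_leviCivita (u := fun _ ↦ 1) hZ hunit (by simp) (by simp) hX]
  simp [mvfderiv_const]

/-- With `u = e^{2h}` one has `½ du = u dh`, so the positive factor `u` cancels and the condition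
for `g` becomes one on `g₀` and `h` alone. -/
theorem isTotallyGeodesic_iff_meanCurvature [T2Space M] {g g₀ : Metric E M} {Z : VField E M}
    {h : M → ℝ} (hZ : IsSmoothField Z) (hunit : ∀ x, g₀.inner x (Z x) (Z x) = 1)
    (hh : ContMDiff 𝓘(ℝ, E) 𝓘(ℝ) ∞ h)
    (hg : ∀ x v, g.inner x (Z x) v = Real.exp (2 * h x) * g₀.inner x (Z x) v) :
    IsTotallyGeodesic g Z ↔ ∀ x, meanCurvature g₀ Z x = horizontalGradient g₀ Z h x := by
  have hd (x : M) (v : TangentSpace 𝓘(ℝ, E) x) :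
      mvfderiv 𝓘(ℝ, E) (fun y ↦ Real.exp (2 * h y)) x v =
        2 * Real.exp (2 * h x) * mvfderiv 𝓘(ℝ, E) h x v := by
    refine mvfderiv_comp_real (φ := fun t ↦ Real.exp (2 * t)) ?_
      ((hh x).mdifferentiableAt (by simp)) v
    simpa [mul_comm] using ((hasDerivAt_id (h x)).const_mul 2).exp
  rw [isTotallyGeodesic_iff hZ hunit (fun x ↦ (Real.exp_pos (2 * h x)).ne') hg]
  have key (X : VField E M) (hX : IsSmoothField X) (x : M) :
      ((1 / 2) * mvfderiv 𝓘(ℝ, E) (fun y ↦ Real.exp (2 * h y)) x (prD g₀ Z x (X x)) =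
        - (Real.exp (2 * h x) *
          g₀.inner x (Z x) (mlieBracket 𝓘(ℝ, E) Z (fun y ↦ prD g₀ Z y (X y)) x))) ↔
      g₀.inner x (meanCurvature g₀ Z x) (X x) =
        g₀.inner x (horizontalGradient g₀ Z h x) (X x) := by
    rw [inner_meanCurvature hZ hunit hX, horizontalGradient, inner_sharp, hd,
      ContinuousLinearMap.comp_apply]
    have := Real.exp_pos (2 * h x)
    constructor
    · intro h1
      refine mul_left_cancel₀ this.ne' ?_
      linarith
    · intro h1
      rw [← h1]
      ring
  constructor
  · intro H x
    refine ext_inner g₀ x fun w ↦ ?_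
    obtain ⟨X, hX, rfl⟩ := exists_smooth_extension w
    exact (key X hX x).1 (H X hX x)
  · intro H X hX x
    rw [key X hX x, H x]

/-- The conformal rescaling `e^{2h} g`. -/
def conformal (g : Metric E M) (h : M → ℝ) (hh : ContMDiff 𝓘(ℝ, E) 𝓘(ℝ) ∞ h) : Metric E M where
  inner x := Real.exp (2 * h x) • g.inner x
  symm x v w := by simp [g.symm x v w]
  pos x v hv := by simpa using mul_pos (Real.exp_pos _) (g.pos x v hv)
  -- The unit ball of `e^{2h} g` is the image of that of `g` under multiplication by `e^{-h}`.
  isVonNBounded x := by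
    refine ((g.isVonNBounded x).image
      ((Real.exp (h x))⁻¹ • ContinuousLinearMap.id ℝ (TangentSpace 𝓘(ℝ, E) x))).subset ?_
    intro v hv
    refine ⟨Real.exp (h x) • v, ?_, ?_⟩
    · simpa [two_mul, Real.exp_add, mul_assoc] using hv
    · simp [smul_smul, (Real.exp_pos (h x)).ne']
  contMDiff := by
    have h1 : ContMDiff 𝓘(ℝ, E) 𝓘(ℝ) ∞ (fun x ↦ Real.exp (2 * h x)) :=
      (Real.contDiff_exp.comp (contDiff_const.mul contDiff_id)).contMDiff.comp hh
    exact ContMDiff.smul_section h1 g.contMDiff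

end TotallyGeodesic

/-! ### Assembly of the two implications. -/

section Main

variable {E : Type*} [NormedAddCommGroup E] [NormedSpace ℝ E] [FiniteDimensional ℝ E]
  {M : Type*} [TopologicalSpace M] [ChartedSpace E M] [IsManifold 𝓘(ℝ, E) ∞ M]

theorem isScaling_exp_neg {g : Metric E M} {Z : VField E M} {h : M → ℝ}
    (hZ : IsSmoothField Z) (hunit : ∀ x, g.inner x (Z x) (Z x) = 1)
    (hh : ContMDiff 𝓘(ℝ, E) 𝓘(ℝ) ∞ h)
    (hN : ∀ x, meanCurvature g Z x = horizontalGradient g Z h x) :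
    IsScaling g Z (fun x ↦ Real.exp (- h x)) where
  smooth := (Real.contDiff_exp.comp contDiff_neg).contMDiff.comp hh
  pos x := Real.exp_pos _
  inner_mlieBracket W hW hWZ x := by
    have hp : (fun y ↦ prD g Z y (W y)) = W := by
      ext y; simp [prD_apply_of_unit g (hunit y), hWZ]
    have h1 := inner_meanCurvature hZ hunit hW x
    rw [hN x, horizontalGradient, inner_sharp, ContinuousLinearMap.comp_apply, hp,
      show prD g Z x (W x) = W x from congrFun hp x] at h1
    rw [mvfderiv_comp_real (φ := fun t ↦ Real.exp (- t)) (φ' := - Real.exp (- h x))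
      (by simpa using (hasDerivAt_neg (h x)).exp) ((hh x).mdifferentiableAt (by simp)), h1]
    ring

theorem mvfderiv_prD_of_unit (g : Metric E M) {Z : VField E M} {x : M}
    (hunit : g.inner x (Z x) (Z x) = 1) {f : M → ℝ} (hf : mvfderiv 𝓘(ℝ, E) f x (Z x) = 0)
    (v : TangentSpace 𝓘(ℝ, E) x) :
    mvfderiv 𝓘(ℝ, E) f x (prD g Z x v) = mvfderiv 𝓘(ℝ, E) f x v := by
  simp [prD_apply_of_unit g hunit, hf]

/-- A function constant along the leaves has equal gradient and horizontal gradient. -/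
theorem horizontalGradient_eq_neg_add_gradient (g : Metric E M) {Z : VField E M} {h r f : M → ℝ}
    {x : M} (hunit : g.inner x (Z x) (Z x) = 1) (hh : MDiffAt h x) (hr : MDiffAt r x)
    (hf : ∀ y, f y = h y + r y) (hfZ : mvfderiv 𝓘(ℝ, E) f x (Z x) = 0) :
    horizontalGradient g Z h x = - horizontalGradient g Z r x + gradient g f x := by
  obtain rfl : f = h + r := funext hf
  refine ext_inner g x fun w ↦ ?_
  simp only [map_add, map_neg, _root_.add_apply, _root_.neg_apply, horizontalGradient, gradient,
    inner_sharp, ContinuousLinearMap.comp_apply]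
  rw [← mvfderiv_prD_of_unit g hunit hfZ, mvfderiv_add hh hr]
  simp

/-- Pair the identity with `Z`: `N` and the horizontal gradient are orthogonal to `Z`. -/
theorem mvfderiv_eq_zero_of_meanCurvature (g : Metric E M) {Z : VField E M} {r f : M → ℝ} {x : M}
    (hunit : g.inner x (Z x) (Z x) = 1)
    (hN : meanCurvature g Z x = - horizontalGradient g Z r x + gradient g f x) :
    mvfderiv 𝓘(ℝ, E) f x (Z x) = 0 := by
  have h0 : prD g Z x (Z x) = 0 := prD_self g (ne_zero_of_unit g hunit)
  have h1 := congr(g.inner x $hN (Z x))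
  simpa [meanCurvature, secondFundamentalForm, inner_prD_left, horizontalGradient, gradient,
    inner_sharp, h0] using h1.symm

/-- Both covectors vanish on `D`, so they are proportional; evaluating at `Z` gives the factor `g(Z,
Z)`, whence `h = ½ log g(Z, Z)`. -/
theorem exists_log_factor {g g₀ : Metric E M} {Z : VField E M} (hZ : IsSmoothField Z)
    (hunit : ∀ x, g₀.inner x (Z x) (Z x) = 1)
    (horth : ∀ x, ∀ v ∈ horizontal g₀ Z x, ∀ w ∈ vertical Z x, g.inner x v w = 0) :
    ∃ h : M → ℝ, ContMDiff 𝓘(ℝ, E) 𝓘(ℝ) ∞ h ∧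
      ∀ x v, g.inner x (Z x) v = Real.exp (2 * h x) * g₀.inner x (Z x) v := by
  have hpos (x : M) : 0 < g.inner x (Z x) (Z x) := g.pos x _ (ne_zero_of_unit g₀ (hunit x))
  refine ⟨fun x ↦ (1 / 2) * Real.log (innerFun g Z Z x), fun x ↦ ?_, fun x v ↦ ?_⟩
  · exact contMDiffAt_const.mul
      ((Real.contDiffAt_log.2 (hpos x).ne').contMDiffAt.comp x (contMDiff_innerFun g hZ hZ x))
  · have h1 : g.inner x (Z x) (prD g₀ Z x v) = 0 := by
      rw [g.symm]
      exact horth x _ (inner_prD_of_unit g₀ (hunit x) v) _ (Submodule.mem_span_singleton_self _)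
    rw [prD_apply_of_unit g₀ (hunit x)] at h1
    simp only [map_sub, map_smul, smul_eq_mul, sub_eq_zero] at h1
    rw [h1, ← mul_assoc, mul_one_div_cancel two_ne_zero, one_mul, innerFun, Real.exp_log (hpos x),
      mul_comm]

end Main

end LineFoliation

end

theorem mainTheorem9
    {E : Type*} [NormedAddCommGroup E] [NormedSpace ℝ E] [FiniteDimensional ℝ E]
    {M : Type*} [TopologicalSpace M] [ChartedSpace E M] [IsManifold 𝓘(ℝ, E) ∞ M]
    [T2Space M] [SecondCountableTopology M] [SimplyConnectedSpace M]
    (g₀ : LineFoliation.Metric E M)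
    (Z : LineFoliation.VField E M) (hZ : LineFoliation.IsSmoothField Z)
    (hunit : ∀ x, g₀.inner x (Z x) (Z x) = 1)
    (hRiem : LineFoliation.IsRiemannianFoliation g₀ Z)
    (hcurv : ∀ x, ∃ v w, LineFoliation.curvatureAt g₀ Z x v w ≠ 0) :
    (∃ g : LineFoliation.Metric E M,
      (∀ x, ∀ v ∈ LineFoliation.horizontal g₀ Z x, ∀ w ∈ LineFoliation.vertical Z x,
        g.inner x v w = 0) ∧
      LineFoliation.IsTotallyGeodesic g Z) ↔
    ∃ f : M → ℝ, ContMDiff 𝓘(ℝ, E) 𝓘(ℝ) ∞ f ∧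
      ∀ x, LineFoliation.meanCurvature g₀ Z x =
        - LineFoliation.horizontalGradient g₀ Z
            (fun y ↦ Real.log (LineFoliation.curvatureNorm g₀ Z y)) x
          + LineFoliation.gradient g₀ f x := by
  have hr := LineFoliation.contMDiff_log_curvatureNorm g₀ hZ hunit hcurv
  have hrd (x : M) := (hr x).mdifferentiableAt (by simp)
  constructor
  · rintro ⟨g, horth, hgeod⟩
    obtain ⟨h, hh, hg⟩ := LineFoliation.exists_log_factor hZ hunit horth
    have hN := (LineFoliation.isTotallyGeodesic_iff_meanCurvature hZ hunit hh hg).1 hgeod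
    -- The witness is `f = h + log ‖ℛ‖`.
    refine ⟨_, hh.add hr, fun x ↦ ?_⟩
    rw [hN x]
    refine LineFoliation.horizontalGradient_eq_neg_add_gradient g₀ (hunit x)
      ((hh x).mdifferentiableAt (by simp)) (hrd x) (fun y ↦ rfl) ?_
    have h1 := (LineFoliation.isScaling_exp_neg hZ hunit hh hN).mvfderiv_log_curvatureNorm hZ hunit
      hRiem hcurv x
    convert! h1 using 3
    ext y
    simp [add_comm]
  · rintro ⟨f, hf, hN⟩
    -- The conformal exponent is `h = f - log ‖ℛ‖`.
    refine ⟨LineFoliation.conformal g₀ _ (hf.sub hr), fun x v hv w hw ↦ ?_, ?_⟩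
    · obtain ⟨c, rfl⟩ := Submodule.mem_span_singleton.1 hw
      have hv' : g₀.inner x (Z x) v = 0 := hv
      simp [LineFoliation.conformal, g₀.symm x v, hv']
    · rw [LineFoliation.isTotallyGeodesic_iff_meanCurvature hZ hunit (hf.sub hr) (fun _ _ ↦ rfl)]
      intro x
      rw [hN x, LineFoliation.horizontalGradient_eq_neg_add_gradient g₀ (hunit x)
        (((hf.sub hr) x).mdifferentiableAt (by simp)) (hrd x) (fun y ↦ by simp)
        (LineFoliation.mvfderiv_eq_zero_of_meanCurvature g₀ (hunit x) (hN x))]
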